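/- Let $1\le m$ and $n$ be integers, let $\varepsilon_0,b>0$, and let $M$ be a closed (compact, Hausdorff, without boundary, not necessarily connected) $m$-dimensional manifold of class $C^2$. **The space of submanifolds.** Let $\mathrm{Imm}^2(M,\mathbb R^n)$ be the set of $C^2$ immersions $f\colon M\to\mathbb R^n$ with the compact-open $C^2$ topology (uniform closeness in charts, on compact sets, of the maps and of all their partial derivatives of order at most $2$). An immersed submanifold parametrized by $M$ is an element $[f]$ of the quotient space $\mathrm{Imm}^2(M,\mathbb R^n)/\mathrm{Diff}^2(M)$ with the quotient topology (the $C^2$-topology); it is embedded if $f$ is an embedding, and it has a double point if $f(p)=f(p')$ for some $p\ne p'$. **The class $\mathcal M(2,\varepsilon_0,b,\infty)$** consists of those $[f]$ such that for every $x\in f(M)$ the preimage $f^{-1}(B_{\varepsilon_0}(x))$ of the open ball of radius $\varepsilon_0$ is a disjoint union of finitely many open sets $W_1,\dots,W_\ell$, each $W_i$ is $C^2$-diffeomorphic to an open $m$-ball, $f|_{W_i}$ is a $C^2$-diffeomorphism onto $f(W_i)$, and each $f(W_i)$ that contains $x$ is, in coordinates with origin $x$, the graph of a $C^2$ function $h_i\colon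 U_i\to (T_xf(W_i))^\perp$, $U_i\subset T_xf(W_i)$ open, with $|\partial^\mu h_i|\le b$ on $U_i$ for all orthogonal axes of $T_xf(W_i)$ and all multi-indices $0\le|\mu|\le2$. (There is no bound on the volume.) **The energy.** Let $N=f(M)\subset\mathbb R^n$ be an embedded submanifold with an orientation. For distinct $x,y\in N$ let $\Sigma_x(y)$ be the $m$-sphere (an $m$-plane if $y\in x+T_xN$) that is tangent to $N$ at $x$ and passes through $y$, with the orientation that agrees with that of $N$ at $x$. Let $u_1,\dots,u_m$ and $v_1,\dots,v_m$ be positively oriented orthonormal bases of $T_y\Sigma_x(y)$ and $T_yN$. The combined angle $\theta_N(x,y)$ is given by $\cos\theta_N(x,y)=\det(\langle u_i,v_j\rangle)$, and the Kusner–Sullivan energy is $$E_{KS}(N)=\iint_{N\times N}\frac{(1-\cos\theta_N(x,y))^m}{|x-y|^{2m}}\,dx\,dy\in[0,\infty],$$ where $dx$, $dy$ are the $m$-dimensional volume. **Theorem.** $E_{KS}$ is self-repulsive on $\mathcal M(2,\varepsilon_0,b,\infty)$ with respect to the $C^2$-topology: if $N_\infty\in\mathcal M(2,\varepsilon_0,b,\infty)$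 is an immersed submanifold parametrized by $M$ that has a double point (transversal or tangential), then for every $C\ge 0$ there is a neighbourhood $\mathcal U$ of $N_\infty$ in $\mathrm{Imm}^2(M,\mathbb R^n)/\mathrm{Diff}^2(M)$ such that $E_{KS}(N)>C$ for every embedded submanifold $N\in\mathcal U$ and every orientation of $N$. In particular, if embedded $C^2$ submanifolds $N_k$ converge to $N_\infty$ in the $C^2$-topology, then $E_{KS}(N_k)\to\infty$. -/

import Mathlib

open Set Filter Topology MeasureTheory
open scoped Manifold ContDiff ENNReal NNReal

namespace KusnerSullivan

noncomputable section

/-- Euclidean space `ℝ^n`. -/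
abbrev Eu (n : ℕ) : Type := EuclideanSpace ℝ (Fin n)

/-! ### The weak `C^q` topology -/

/-- The partial derivative `∂^μ F (x)` of order `j`, where the multi-index `μ` lists the coordinate
directions `s 0, …, s (j-1)` with repetitions. -/
def partialDeriv {m n j : ℕ} (s : Fin j → Fin m) (F : Eu m → Eu n) (x : Eu m) : Eu n :=
  iteratedFDeriv ℝ j F x (fun i => EuclideanSpace.single (s i) (1 : ℝ))

section Weak

variable {m n : ℕ} (k : WithTop ℕ∞) (q : ℕ)
  (M : Type*) [TopologicalSpace M] [ChartedSpace (Eu m) M]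
  (N : Type*) [TopologicalSpace N] [ChartedSpace (Eu n) N]

variable {k M N} in
/-- The set of all `g` with `g(K) ⊆ V` whose local expression `ψ g φ⁻¹` is `ε`-close to `ψ f φ⁻¹`
on `φ(K)`, together with all partial derivatives of order at most `q`. -/
def weakNhd (f : C^k⟮𝓡 m, M; 𝓡 n, N⟯) (φ : OpenPartialHomeomorph M (Eu m))
    (ψ : OpenPartialHomeomorph N (Eu n)) (K : Set M) (ε : ℝ) : Set C^k⟮𝓡 m, M; 𝓡 n, N⟯ :=
  {g | MapsTo g K ψ.source ∧ ∀ x ∈ φ '' K, ∀ j ≤ q, ∀ s : Fin j → Fin m,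
    ‖partialDeriv s (ψ ∘ g ∘ φ.symm) x - partialDeriv s (ψ ∘ f ∘ φ.symm) x‖ < ε}

/-- The compact-open `C^q` topology (weak topology) on `C^k(M, N)`. -/
abbrev weakTopology : TopologicalSpace C^k⟮𝓡 m, M; 𝓡 n, N⟯ :=
  TopologicalSpace.generateFrom
    {𝒩 | ∃ (f : C^k⟮𝓡 m, M; 𝓡 n, N⟯) (φ : OpenPartialHomeomorph M (Eu m))
        (ψ : OpenPartialHomeomorph N (Eu n)) (K : Set M) (ε : ℝ),
      φ ∈ IsManifold.maximalAtlas (𝓡 m) k M ∧ ψ ∈ IsManifold.maximalAtlas (𝓡 n) k N ∧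
      IsCompact K ∧ K ⊆ φ.source ∧ MapsTo f K ψ.source ∧ 0 < ε ∧
      𝒩 = weakNhd q f φ ψ K ε}

end Weak

/-! ### The space of immersed submanifolds -/

section Immersions

/-- The space `Imm^k_q(M, ℝ^n)` of `C^k` immersions of the `m`-manifold `M` into `ℝ^n`; the index `q`
records that it carries the `C^q` topology. -/
def Imm (m n : ℕ) (k : WithTop ℕ∞) (_q : ℕ)
    (M : Type*) [TopologicalSpace M] [ChartedSpace (Eu m) M] : Type _ :=
  {f : C^k⟮𝓡 m, M; 𝓡 n, Eu n⟯ // ∀ p, Function.Injective (mfderiv (𝓡 m) (𝓡 n) f p)}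

variable (m n : ℕ) (k : WithTop ℕ∞) (q : ℕ)
  (M : Type*) [TopologicalSpace M] [ChartedSpace (Eu m) M]

instance : TopologicalSpace (Imm m n k q M) :=
  (weakTopology k q M (Eu n)).induced Subtype.val

instance : CoeFun (Imm m n k q M) (fun _ => M → Eu n) := ⟨fun f => f.1⟩

/-- Two immersions are equivalent if they differ by a `C^k` diffeomorphism of `M`. -/
instance immSetoid : Setoid (Imm m n k q M) where
  r f g := ∃ φ : M ≃ₘ^k⟮𝓡 m, 𝓡 m⟯ M, ∀ p, g p = f (φ p)
  iseqv :=
    { refl := fun _ => ⟨Diffeomorph.refl (𝓡 m) M k, fun _ => rfl⟩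
      symm := by
        rintro f g ⟨φ, h⟩
        exact ⟨φ.symm, fun p => by rw [h, Diffeomorph.apply_symm_apply]⟩
      trans := by
        rintro f g l ⟨φ, h⟩ ⟨χ, h'⟩
        exact ⟨χ.trans φ, fun p => by rw [h', h]; rfl⟩ }

/-- The space `Imm^k_q(M, ℝ^n) / Diff^k(M)` of immersed submanifolds of `ℝ^n` that are parametrized
by `M`, with the quotient of the `C^q` topology. The space of all closed immersed submanifolds is
the topological disjoint union of these spaces over the diffeomorphism types of closed `M`, so a
neighbourhood of a point parametrized by `M` may be taken in the space belonging to `M`. -/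
abbrev ImmSubmfd : Type _ := Quotient (immSetoid m n k q M)

end Immersions

section Geometry

variable {m n : ℕ} {k : WithTop ℕ∞} {q : ℕ}
  {M : Type*} [TopologicalSpace M] [ChartedSpace (Eu m) M]

/-- The immersed submanifold has a double point. -/
def HasDoublePoint (N : ImmSubmfd m n k q M) : Prop :=
  ∃ f : Imm m n k q M, ⟦f⟧ = N ∧ ∃ p p' : M, p ≠ p' ∧ f p = f p'

/-- The tangent plane `df(T_p M)`, a linear subspace of `ℝ^n`. -/
def tangentPlane (f : M → Eu n) (p : M) : Submodule ℝ (Eu n) :=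
  LinearMap.range (mfderiv (𝓡 m) (𝓡 n) f p).toLinearMap

/-- `f` restricts to a `C^k` diffeomorphism from the set `s` onto the set `t`. -/
def IsDiffeoOn {m₁ m₂ : ℕ} (k : WithTop ℕ∞)
    {M₁ : Type*} [TopologicalSpace M₁] [ChartedSpace (Eu m₁) M₁]
    {M₂ : Type*} [TopologicalSpace M₂] [ChartedSpace (Eu m₂) M₂]
    (f : M₁ → M₂) (s : Set M₁) (t : Set M₂) : Prop :=
  ContMDiffOn (𝓡 m₁) (𝓡 m₂) k f s ∧ MapsTo f s t ∧
    ∃ g : M₂ → M₁, ContMDiffOn (𝓡 m₂) (𝓡 m₁) k g t ∧ MapsTo g t s ∧ InvOn g f s t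

/-- The set `W' ∋ x` is the graph, in the coordinates with origin `x`, of a `C^k` function
`h : U → Tᗮ`, `U ⊆ T` open, all of whose partial derivatives of order `0 ≤ |μ| ≤ k` with respect to
any orthogonal axes of `T` are bounded by `b` on `U`. -/
def IsBoundedGraph (k : WithTop ℕ∞) (b : ℝ) (x : Eu n) (T : Submodule ℝ (Eu n))
    (W' : Set (Eu n)) : Prop :=
  ∃ (U : Set T) (h : T → Tᗮ), IsOpen U ∧ ContDiffOn ℝ k h U ∧
    W' = (fun η : T => x + ((η : Eu n) + (h η : Eu n))) '' U ∧
    ∀ (e : OrthonormalBasis (Fin (Module.finrank ℝ T)) ℝ T) (j : ℕ), (j : WithTop ℕ∞) ≤ k →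
      ∀ (s : Fin j → Fin (Module.finrank ℝ T)), ∀ η ∈ U,
        ‖iteratedFDeriv ℝ j h η (fun i => e (s i))‖ ≤ b

/-- The volume of the immersed submanifold `f(M)`, counted with multiplicity. -/
def immVolume (m : ℕ) {n : ℕ} {M : Type*} (f : M → Eu n) : ℝ≥0∞ :=
  ∫⁻ y, ((f ⁻¹' {y}).encard : ℝ≥0∞) ∂(μHE[m] : Measure (Eu n))

/-- The class `𝓜(k, ε₀, b, V)` of closed immersed submanifolds of bounded geometry (here those that
are parametrized by `M`). For every point `x` of the submanifold the preimage of the ball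
`B_{ε₀}(x)` is a disjoint union of finitely many sets `W i` that are `C^k` diffeomorphic to an
`m`-ball and mapped `C^k` diffeomorphically onto their images, and every image `f '' W i` through `x`
is a graph over its tangent plane at `x` of a function with derivatives bounded by `b`. -/
def boundedGeometry (m n : ℕ) (k : WithTop ℕ∞) (q : ℕ)
    (M : Type*) [TopologicalSpace M] [ChartedSpace (Eu m) M]
    (ε₀ b : ℝ) (V : ℝ≥0∞) : Set (ImmSubmfd m n k q M) :=
  {N | ∃ f : Imm m n k q M, ⟦f⟧ = N ∧ immVolume m f ≤ V ∧
    ∀ x ∈ range f, ∃ (l : ℕ) (W : Fin l → Set M),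
      f ⁻¹' Metric.ball x ε₀ = ⋃ i, W i ∧
      Pairwise (fun i j => Disjoint (W i) (W j)) ∧
      ∀ i, IsOpen (W i) ∧
        (∃ φ : Eu m → M, IsDiffeoOn (m₁ := m) (m₂ := m) k φ (Metric.ball 0 1) (W i)) ∧
        IsDiffeoOn (m₁ := m) (m₂ := n) k f (W i) (f '' W i) ∧
        ∀ p ∈ W i, f p = x → IsBoundedGraph k b x (tangentPlane (m := m) f p) (f '' W i)}

/-! ### Orientations, the combined angle and the energy -/

/-- An orientation of the manifold `M`: an orientation of every tangent space which is locally
constant with respect to the coordinate changes of the tangent bundle. -/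
structure MfdOrientation (m : ℕ) (M : Type*) [TopologicalSpace M] [ChartedSpace (Eu m) M]
    [IsManifold (𝓡 m) 1 M] where
  at_ : ∀ p : M, Orientation ℝ (TangentSpace (𝓡 m) p) (Fin m)
  locallyConst : ∀ p : M, ∀ᶠ p' in 𝓝 p,
    ∀ (v : Module.Basis (Fin m) ℝ (TangentSpace (𝓡 m) p))
      (w : Module.Basis (Fin m) ℝ (TangentSpace (𝓡 m) p')),
      (∀ i, w i = tangentCoordChange (𝓡 m) p p' p' (v i)) →
        (v.orientation = at_ p ↔ w.orientation = at_ p')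

/-- The matrix `(⟨a i, b j⟩)`. -/
def gram {r n : ℕ} (a b : Fin r → Eu n) : Matrix (Fin r) (Fin r) ℝ :=
  Matrix.of fun i j => inner ℝ (a i) (b j)

/-- `v` is a positively oriented ordered orthonormal basis of the tangent space at the point `x` of
the embedded oriented submanifold `f(M)`. -/
def IsPosFrame [IsManifold (𝓡 m) 1 M] (f : M → Eu n) (o : MfdOrientation m M) (x : Eu n)
    (v : Fin m → Eu n) : Prop :=
  Orthonormal ℝ v ∧ ∃ p : M, f p = x ∧
    ∃ β : Module.Basis (Fin m) ℝ (TangentSpace (𝓡 m) p), β.orientation = o.at_ p ∧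
      ∀ i, v i = mfderiv (𝓡 m) (𝓡 n) f p (β i)

/-- Let `a` be an ordered orthonormal basis of an `m`-plane `T`, and let `Σ` be the `m`-sphere that
is tangent to `x + T` at `x` and passes through `y`, with the orientation that agrees at `x` with the
one of `a`. Then `u` is a positively oriented ordered orthonormal basis of `T_y Σ`.

If `y - x ∈ T`, then `Σ` is the plane `x + T` (a sphere through infinity). Otherwise `Σ` is the
sphere with centre `c` and radius `|x - c| = |y - c|` in the affine `(m+1)`-space
`x + T + ℝ (y - x)`, where `c - x ⊥ T`; the orientations of `T_x Σ` and `T_y Σ` correspond to each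
other iff the bases `(x - c, a)` and `(y - c, u)`, obtained by prefixing the radial vectors, give
this `(m+1)`-space the same orientation. Two bases of a Euclidean space have the same orientation
iff the determinant of their mixed Gram matrix is positive. -/
def IsPosSphereFrame (x : Eu n) (a : Fin m → Eu n) (y : Eu n) (u : Fin m → Eu n) : Prop :=
  Orthonormal ℝ u ∧
    ((y - x ∈ Submodule.span ℝ (range a) ∧
        (∀ i, u i ∈ Submodule.span ℝ (range a)) ∧ 0 < (gram a u).det) ∨
      (y - x ∉ Submodule.span ℝ (range a) ∧
        ∃ c : Eu n, (c - x ∈ Submodule.span ℝ (insert (y - x) (range a))) ∧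
          (∀ i, inner ℝ (a i) (c - x) = 0) ∧ dist x c = dist y c ∧
          (∀ i, u i ∈ Submodule.span ℝ (insert (y - x) (range a))) ∧
          (∀ i, inner ℝ (u i) (y - c) = 0) ∧
          0 < (gram (Fin.cons (x - c) a : Fin (m + 1) → Eu n) (Fin.cons (y - c) u)).det))

/-- The cosine of the combined angle `θ_M(x, y)`: the number `det (⟨u i, v j⟩)`, which is the same
for all positive orthonormal bases `u` of `T_y Σ_x(y)` and `v` of `T_y M`. -/
def cosCombinedAngle [IsManifold (𝓡 m) 1 M] (f : M → Eu n) (o : MfdOrientation m M)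
    (x y : Eu n) : ℝ :=
  Classical.epsilon fun t : ℝ => ∃ a u v : Fin m → Eu n,
    IsPosFrame f o x a ∧ IsPosSphereFrame x a y u ∧ IsPosFrame f o y v ∧ t = (gram u v).det

/-- The Kusner–Sullivan energy of the embedded submanifold `f(M)` with the orientation `o`. -/
def energy [IsManifold (𝓡 m) 1 M] (f : M → Eu n) (o : MfdOrientation m M) : ℝ≥0∞ :=
  ∫⁻ x in range f, ∫⁻ y in range f,
    ENNReal.ofReal ((1 - cosCombinedAngle f o x y) ^ m / dist x y ^ (2 * m))
    ∂(μHE[m] : Measure (Eu n)) ∂(μHE[m] : Measure (Eu n))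

/-- A functional `E` of oriented embedded submanifolds is self-repulsive on the class `𝒞` with
respect to the `C^q` topology: if an immersed submanifold `N₀` in `𝒞` has a double point, then `E`
blows up as an embedded submanifold (with any orientation) approaches `N₀`. -/
def SelfRepulsiveOn [IsManifold (𝓡 m) 1 M]
    (E : (M → Eu n) → MfdOrientation m M → ℝ≥0∞) (𝒞 : Set (ImmSubmfd m n k q M)) : Prop :=
  ∀ N₀ ∈ 𝒞, HasDoublePoint N₀ → ∀ C : ℝ≥0, ∀ᶠ N in 𝓝 N₀,
    ∀ g : Imm m n k q M, ⟦g⟧ = N → IsEmbedding g → ∀ o : MfdOrientation m M, (C : ℝ≥0∞) < E g o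

end Geometry

end

end KusnerSullivan

namespace KusnerSullivan

noncomputable section

/-! ### Gram matrices of frames, and reflections -/

section GramAlgebra

variable {m n r : ℕ}

/-! The argument is local at a double point `q = f p = f p'`. Near `p` and `p'` every nearby
embedding has two disjoint, almost flat sheets A and B passing close to `q`; the pairs `(x, y)` with
`x` in A and `y` in B alone already carry more energy than `C`.

The combined angle is made computable by a reflection. Let `R` be the reflection in the
perpendicular bisector of `x` and `y`. It preserves the sphere tangent at `x` through `y`, exchanges
`x` and `y`, and reverses the orientation of the sphere. Hence for positive orthonormal frames `a`
at `x` and `v` at `y` one has `cos θ = -det ⟨R a i, v j⟩` (`det_gram_of_isPosSphereFrame`), which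
depends continuously on the two frames and on the direction `w` from `x` to `y`. For arbitrary
frames the normalized version is `angleKernel`.

Transversal planes: take `w` tangent to A. Then `R` only changes the orientation of the plane of A,
and Hadamard's inequality gives `|cos θ| ≤ 1 - κ` whatever the orientations. At each dyadic scale `R
i`, points of A at distance about `R i` from `q`, paired with points of B much closer to `q`,
contribute an amount independent of `i`, because the energy is scale invariant. Enough scales exceed
`C` (`exists_lt_pairEnergy_of_transversal`).

Equal planes: `det ⟨R a i, a j⟩` is `1` for normal `w` and `-1` for tangent `w`. Depending on the
relative orientation of the sheets, `cos θ` is therefore near `-1` either for `y` straight across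
from `x` at distance `u`, or for `y` displaced sideways by a large fixed multiple of `u`. In both
cases a ball of radius comparable to `u` in B has obtuse angle and distance of order `u`, so the
inner integral is at least a constant times `u ^ (-m)`. As `u ≤ 8 ε r`, integration over a ball of
radius `r / 4` in A gives order `ε ^ (-m)` (`exists_obtuse_ball`,
`exists_lt_pairEnergy_of_tangential_sign`).

The flatness `ε` needed depends on `C` and the planes but not on the size `r` of the sheets. So `ε`
can be fixed first, then `r` is chosen so that `f` is flat enough, and then a neighbourhood of `f`
(`exists_nearlyFlat`). It remains to fix orientation signs over a whole sheet (`exists_frame_sign`)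
and to pass to the quotient, whose projection is open (`isOpenMap_mk`). -/

@[simp] theorem gram_apply (a b : Fin r → Eu n) (i j : Fin r) :
    gram a b i j = inner ℝ (a i) (b j) := rfl

theorem gram_transpose (a b : Fin r → Eu n) : (gram a b).transpose = gram b a := by
  ext i j
  simp [real_inner_comm]

theorem gram_self_eq_one {a : Fin r → Eu n} (ha : Orthonormal ℝ a) : gram a a = 1 := by
  ext i j
  rw [gram_apply, orthonormal_iff_ite.1 ha i j, Matrix.one_apply]

/-- Expansion along an orthonormal family whose span contains the second family. -/
theorem gram_mul_gram {b : Fin r → Eu n} (hb : Orthonormal ℝ b) (z z' : Fin r → Eu n)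
    (hz : ∀ j, z' j ∈ Submodule.span ℝ (range b)) : gram z b * gram b z' = gram z z' := by
  ext i j
  obtain ⟨c, hc⟩ := (Submodule.mem_span_range_iff_exists_fun ℝ).1 (hz j)
  have hk : ∀ k, inner ℝ (b k) (z' j) = c k := fun k => by
    rw [← hc, hb.inner_right_fintype]
  simp only [Matrix.mul_apply, gram_apply, hk]
  rw [← hc, inner_sum]
  exact Finset.sum_congr rfl fun k _ => by rw [inner_smul_right, mul_comm]

theorem det_gram_sq_eq_one {a b : Fin r → Eu n} (ha : Orthonormal ℝ a) (hb : Orthonormal ℝ b)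
    (h : ∀ i, b i ∈ Submodule.span ℝ (range a)) : (gram a b).det ^ 2 = 1 := by
  have := gram_mul_gram ha b b h
  rw [gram_self_eq_one hb] at this
  have h2 := congrArg Matrix.det this
  rw [Matrix.det_mul, ← gram_transpose a b, Matrix.det_transpose, Matrix.det_one] at h2
  rw [sq, h2]

/-- The reflection in the hyperplane orthogonal to the unit vector `w`. -/
def reflectAlong (w z : Eu n) : Eu n := z - (2 * inner ℝ w z) • w

theorem inner_reflectAlong_left (w x y : Eu n) :
    inner ℝ (reflectAlong w x) y = inner ℝ x y - 2 * inner ℝ x w * inner ℝ w y := by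
  rw [reflectAlong, inner_sub_left, inner_smul_left, real_inner_comm x w]
  simp

theorem inner_reflectAlong {w : Eu n} (hw : ‖w‖ = 1) (x y : Eu n) :
    inner ℝ (reflectAlong w x) (reflectAlong w y) = inner ℝ x y := by
  have h1 : inner ℝ w w = (1 : ℝ) := by rw [real_inner_self_eq_norm_sq, hw]; norm_num
  simp only [reflectAlong, inner_sub_left, inner_sub_right, inner_smul_left, inner_smul_right, h1,
    real_inner_comm w x]
  simp
  ring

theorem reflectAlong_reflectAlong {w : Eu n} (hw : ‖w‖ = 1) (x : Eu n) :
    reflectAlong w (reflectAlong w x) = x := by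
  have h1 : inner ℝ w w = (1 : ℝ) := by rw [real_inner_self_eq_norm_sq, hw]; norm_num
  simp only [reflectAlong, inner_sub_right, inner_smul_right, h1]
  module

theorem reflectAlong_smul (w : Eu n) (c : ℝ) (x : Eu n) :
    reflectAlong w (c • x) = c • reflectAlong w x := by
  simp only [reflectAlong, inner_smul_right]
  module

theorem orthonormal_reflectAlong {w : Eu n} (hw : ‖w‖ = 1) {a : Fin r → Eu n}
    (ha : Orthonormal ℝ a) : Orthonormal ℝ (fun i => reflectAlong w (a i)) := by
  rw [orthonormal_iff_ite] at ha ⊢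
  intro i j
  rw [inner_reflectAlong hw, ha]

/-- The matrix `(⟨R a i, b j⟩)`, where `R` is the reflection along `w`. -/
def reflGram (w : Eu n) (a b : Fin r → Eu n) : Matrix (Fin r) (Fin r) ℝ :=
  gram (fun i => reflectAlong w (a i)) b

theorem reflGram_apply (w : Eu n) (a b : Fin r → Eu n) (i j : Fin r) :
    reflGram w a b i j = inner ℝ (a i) (b j) - 2 * inner ℝ (a i) w * inner ℝ w (b j) := by
  rw [reflGram, gram_apply, inner_reflectAlong_left]

/-- A reflection of a Euclidean space has determinant `-1`. -/
theorem det_reflGram_self {w : Eu n} (hw : ‖w‖ = 1) {b : Fin r → Eu n} (hb : Orthonormal ℝ b)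
    (hwb : w ∈ Submodule.span ℝ (range b)) : (reflGram w b b).det = -1 := by
  have hsum : ∑ k, inner ℝ w (b k) * inner ℝ (b k) w = (1 : ℝ) := by
    obtain ⟨c, hc⟩ := (Submodule.mem_span_range_iff_exists_fun ℝ).1 hwb
    have hk : ∀ k, inner ℝ (b k) w = c k := fun k => by rw [← hc, hb.inner_right_fintype]
    have : inner ℝ w w = (1 : ℝ) := by rw [real_inner_self_eq_norm_sq, hw]; norm_num
    rw [← this]
    conv_rhs => rw [← hc]
    rw [sum_inner]
    refine Finset.sum_congr rfl fun k _ => ?_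
    rw [inner_smul_left, hc, real_inner_comm, hk]
    simp
  -- A rank-one perturbation of the identity: the matrix determinant lemma gives `1 - 2 ‖w‖ ^ 2`,
  -- with `‖w‖ ^ 2` computed by Parseval in `hsum`.
  have : reflGram w b b = 1 + Matrix.replicateCol Unit (fun i => -2 * inner ℝ (b i) w) *
      Matrix.replicateRow Unit (fun j => inner ℝ w (b j)) := by
    ext i j
    rw [reflGram_apply, Matrix.add_apply, ← gram_self_eq_one hb, gram_apply, Matrix.mul_apply]
    simp
    ring
  rw [this, Matrix.det_one_add_replicateCol_mul_replicateRow]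
  have h2 : (fun j => inner ℝ w (b j)) ⬝ᵥ (fun i => -2 * inner ℝ (b i) w) = (-2 : ℝ) := by
    calc _ = -2 * ∑ k, inner ℝ w (b k) * inner ℝ (b k) w := by
          rw [dotProduct, Finset.mul_sum]
          exact Finset.sum_congr rfl fun k _ => by ring
      _ = -2 := by rw [hsum, mul_one]
  rw [h2]; norm_num

/-- Orthogonality kills the first row except for its first entry, so Laplace expansion has a single
term. -/
theorem det_gram_cons {p q : Eu n} {b u : Fin r → Eu n} (h : ∀ j, inner ℝ p (u j) = (0 : ℝ)) :
    (gram (Fin.cons p b : Fin (r + 1) → Eu n) (Fin.cons q u)).det =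
      inner ℝ p q * (gram b u).det := by
  rw [Matrix.det_succ_row_zero, Fin.sum_univ_succ]
  simp only [gram_apply, Fin.cons_zero, Fin.cons_succ, h]
  simp
  left
  congr 1

end GramAlgebra

/-! ### The tangent sphere and the reflection exchanging its two points -/

section Sphere

variable {m n : ℕ}

theorem norm_unitDir {x y : Eu n} (hxy : x ≠ y) : ‖‖y - x‖⁻¹ • (y - x)‖ = 1 := by
  rw [norm_smul, norm_inv, norm_norm, inv_mul_cancel₀]
  exact norm_ne_zero_iff.2 (sub_ne_zero.2 hxy.symm)

/-- A point `c` equidistant from `x` and `y` lies on the perpendicular bisector and is fixed by the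
reflection that exchanges them. Thus radial vectors go to radial vectors. -/
theorem reflectAlong_centre {x y c : Eu n} (hxy : x ≠ y) (hc : dist x c = dist y c) :
    reflectAlong (‖y - x‖⁻¹ • (y - x)) (y - c) = x - c := by
  have hl : ‖y - x‖ ≠ 0 := norm_ne_zero_iff.2 (sub_ne_zero.2 hxy.symm)
  have h : 2 * inner ℝ (y - x) (y - c) = ‖y - x‖ ^ 2 := by
    have h1 : x - c = (y - c) - (y - x) := by abel
    have h2 : ‖x - c‖ ^ 2 = ‖y - c‖ ^ 2 := by rw [← dist_eq_norm, ← dist_eq_norm, hc]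
    rw [h1, norm_sub_sq_real, real_inner_comm] at h2
    linarith
  rw [reflectAlong, inner_smul_left, smul_smul]
  have : 2 * ((starRingEnd ℝ) ‖y - x‖⁻¹ * inner ℝ (y - x) (y - c)) * ‖y - x‖⁻¹ = 1 := by
    simp only [conj_trivial]
    calc _ = (2 * inner ℝ (y - x) (y - c)) * ‖y - x‖⁻¹ ^ 2 := by ring
      _ = 1 := by rw [h]; field_simp
  rw [this, one_smul]
  abel

/-- The orthogonal system at `y` that the reflection in the perpendicular bisector of `x` and `y`
makes of the system at `x` spans the `(m+1)`-space of the sphere. -/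
theorem span_reflected_frame {x y c : Eu n} {a : Fin m → Eu n} (ha : Orthonormal ℝ a) (hxy : x ≠ y)
    (hcE : c - x ∈ Submodule.span ℝ (insert (y - x) (range a)))
    (hca : ∀ i, inner ℝ (a i) (c - x) = (0 : ℝ)) (hc : dist x c = dist y c) :
    Orthonormal ℝ (Fin.cons (‖y - c‖⁻¹ • (y - c))
      (fun i => reflectAlong (‖y - x‖⁻¹ • (y - x)) (a i)) : Fin (m + 1) → Eu n) ∧
    Submodule.span ℝ (range (Fin.cons (‖y - c‖⁻¹ • (y - c))
      (fun i => reflectAlong (‖y - x‖⁻¹ • (y - x)) (a i)) : Fin (m + 1) → Eu n)) =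
      Submodule.span ℝ (insert (y - x) (range a)) := by
  set w := ‖y - x‖⁻¹ • (y - x) with hw
  have hw1 : ‖w‖ = 1 := norm_unitDir hxy
  have hyc : y ≠ c := by
    rintro rfl
    rw [dist_self] at hc
    exact hxy (dist_eq_zero.1 hc)
  have hperp : ∀ i, inner ℝ (reflectAlong w (a i)) (y - c) = (0 : ℝ) := fun i => by
    rw [← inner_reflectAlong hw1, reflectAlong_reflectAlong hw1, reflectAlong_centre hxy hc,
      ← neg_sub c x, inner_neg_right, hca, neg_zero]
  have hR := orthonormal_reflectAlong hw1 ha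
  have hON : Orthonormal ℝ (Fin.cons (‖y - c‖⁻¹ • (y - c))
      (fun i => reflectAlong w (a i)) : Fin (m + 1) → Eu n) := by
    rw [orthonormal_iff_ite]
    have h0 : inner ℝ (‖y - c‖⁻¹ • (y - c)) (‖y - c‖⁻¹ • (y - c)) = (1 : ℝ) := by
      rw [real_inner_self_eq_norm_sq, norm_unitDir hyc.symm]; norm_num
    intro i j
    refine Fin.cases ?_ (fun i => ?_) i <;> refine Fin.cases ?_ (fun j => ?_) j
    · simpa using h0
    · simp only [Fin.cons_zero, Fin.cons_succ]
      rw [inner_smul_left, real_inner_comm, hperp, if_neg (Fin.succ_ne_zero j).symm]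
      simp
    · simp only [Fin.cons_zero, Fin.cons_succ]
      rw [inner_smul_right, hperp, if_neg (Fin.succ_ne_zero i)]
      simp
    · simp only [Fin.cons_succ, Fin.succ_inj]
      exact orthonormal_iff_ite.1 hR i j
  refine ⟨hON, ?_⟩
  set E := Submodule.span ℝ (insert (y - x) (range a)) with hE
  have hyx : y - x ∈ E := Submodule.subset_span (mem_insert _ _)
  have hwE : w ∈ E := E.smul_mem _ hyx
  have hle : Submodule.span ℝ (range (Fin.cons (‖y - c‖⁻¹ • (y - c))
      (fun i => reflectAlong w (a i)) : Fin (m + 1) → Eu n)) ≤ E := by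
    rw [Submodule.span_le]
    rintro _ ⟨i, rfl⟩
    refine Fin.cases ?_ (fun i => ?_) i
    · simp only [Fin.cons_zero]
      refine E.smul_mem _ ?_
      rw [← sub_sub_sub_cancel_right y c x]
      exact E.sub_mem hyx hcE
    · simp only [Fin.cons_succ]
      exact E.sub_mem (Submodule.subset_span (mem_insert_of_mem _ (mem_range_self i)))
        (E.smul_mem _ hwE)
  -- Dimension count: `m + 1` orthonormal vectors inside a space generated by `m + 1` vectors.
  refine Submodule.eq_of_le_of_finrank_le hle ?_
  rw [finrank_span_eq_card hON.linearIndependent, Fintype.card_fin]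
  have : insert (y - x) (range a) = range (Fin.cons (y - x) a : Fin (m + 1) → Eu n) := by
    rw [Fin.range_cons]
  rw [hE, this]
  exact (finrank_range_le_card _).trans_eq (Fintype.card_fin _)

/-- The determinant factors through the reflected system at `y`. The first factor is a reflection of
the `(m+1)`-space, up to the length of the radius, and yields the minus sign; the second is block
triangular because `u` is orthogonal to the radius. Positivity of the left side, the orientation
condition on the sphere, thus says that `u` is negatively oriented relative to the reflected frame.
-/
theorem det_gram_radial {x y c : Eu n} {a u : Fin m → Eu n} (ha : Orthonormal ℝ a) (hxy : x ≠ y)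
    (hcE : c - x ∈ Submodule.span ℝ (insert (y - x) (range a)))
    (hca : ∀ i, inner ℝ (a i) (c - x) = (0 : ℝ)) (hc : dist x c = dist y c)
    (huE : ∀ i, u i ∈ Submodule.span ℝ (insert (y - x) (range a)))
    (huc : ∀ i, inner ℝ (u i) (y - c) = (0 : ℝ)) :
    (gram (Fin.cons (x - c) a : Fin (m + 1) → Eu n) (Fin.cons (y - c) u)).det =
      -(‖y - c‖ ^ 2 * (reflGram (‖y - x‖⁻¹ • (y - x)) a u).det) := by
  obtain ⟨hON, hspan⟩ := span_reflected_frame ha hxy hcE hca hc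
  set w := ‖y - x‖⁻¹ • (y - x) with hw
  have hw1 : ‖w‖ = 1 := norm_unitDir hxy
  set β : Fin (m + 1) → Eu n :=
    Fin.cons (‖y - c‖⁻¹ • (y - c)) (fun i => reflectAlong w (a i)) with hβ
  have hyc : y ≠ c := by
    rintro rfl
    rw [dist_self] at hc
    exact hxy (dist_eq_zero.1 hc)
  have hρ : ‖y - c‖ ≠ 0 := norm_ne_zero_iff.2 (sub_ne_zero.2 hyc)
  have hyx : y - x ∈ Submodule.span ℝ (insert (y - x) (range a)) :=
    Submodule.subset_span (mem_insert _ _)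
  have hmem : ∀ j, (Fin.cons (y - c) u : Fin (m + 1) → Eu n) j ∈ Submodule.span ℝ (range β) := by
    intro j
    rw [hspan]
    refine Fin.cases ?_ (fun i => ?_) j
    · rw [Fin.cons_zero, ← sub_sub_sub_cancel_right y c x]
      exact Submodule.sub_mem _ hyx hcE
    · exact huE i
  rw [← gram_mul_gram hON _ _ hmem, Matrix.det_mul]
  have h2 : (gram β (Fin.cons (y - c) u)).det = ‖y - c‖ * (reflGram w a u).det := by
    rw [hβ, det_gram_cons, reflGram, inner_smul_left, real_inner_self_eq_norm_sq]
    · congr 1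
      simp only [conj_trivial]
      field_simp
    · intro j
      rw [inner_smul_left, real_inner_comm, huc, mul_zero]
  -- Reflecting `β` back gives `(x - c, a)`, except that the radial vector has been normalized; the
  -- diagonal matrix restores its length.
  have h1 : gram (Fin.cons (x - c) a : Fin (m + 1) → Eu n) β =
      Matrix.diagonal (Fin.cons ‖y - c‖ (fun _ => 1) : Fin (m + 1) → ℝ) * reflGram w β β := by
    ext i j
    rw [Matrix.diagonal_mul, reflGram, gram_apply, gram_apply]
    refine Fin.cases ?_ (fun i => ?_) i
    · simp only [Fin.cons_zero, hβ]
      rw [reflectAlong_smul, hw, reflectAlong_centre hxy hc]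
      simp only [inner_smul_left, conj_trivial]
      field_simp
    · simp only [Fin.cons_succ, hβ, reflectAlong_reflectAlong hw1, one_mul]
  rw [h2, h1, Matrix.det_mul, Matrix.det_diagonal, Fin.prod_univ_succ,
    det_reflGram_self hw1 hON (by rw [hspan]; exact Submodule.smul_mem _ _ hyx)]
  simp
  ring

/-- The positive frames of the tangent sphere at `y` are, up to orientation, the reflections of those
at `x` in the perpendicular bisector of `x` and `y`. -/
theorem det_gram_of_isPosSphereFrame {x y : Eu n} {a u : Fin m → Eu n} (ha : Orthonormal ℝ a)
    (hxy : x ≠ y) (hu : IsPosSphereFrame x a y u) (v : Fin m → Eu n) :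
    (gram u v).det = -(reflGram (‖y - x‖⁻¹ • (y - x)) a v).det := by
  set w := ‖y - x‖⁻¹ • (y - x) with hw
  have hw1 : ‖w‖ = 1 := norm_unitDir hxy
  have hR := orthonormal_reflectAlong hw1 ha
  obtain ⟨huON, ⟨hyx, hua, hpos⟩ | ⟨hyx, c, hcE, hca, hc, huE, huc, hpos⟩⟩ := hu
  -- Plane case: `u` and the reflected frame both span the plane of `a`, with determinants `1` and
  -- `-1` relative to `a`, so their matrices against `v` differ by a sign.
  · have hsq := det_gram_sq_eq_one ha huON hua
    have h1 : (gram a u).det = 1 := by nlinarith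
    have hwa : w ∈ Submodule.span ℝ (range a) := Submodule.smul_mem _ _ hyx
    have e1 := gram_mul_gram ha v u hua
    have e2 := gram_mul_gram ha v (fun i => reflectAlong w (a i)) fun i =>
      Submodule.sub_mem _ (Submodule.subset_span (mem_range_self i)) (Submodule.smul_mem _ _ hwa)
    have e3 := det_reflGram_self hw1 ha hwa
    have d1 := congrArg Matrix.det e1
    have d2 := congrArg Matrix.det e2
    rw [Matrix.det_mul, h1, mul_one, ← Matrix.det_transpose (gram v u), gram_transpose] at d1
    rw [reflGram, ← Matrix.det_transpose, gram_transpose] at e3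
    rw [Matrix.det_mul, e3, ← Matrix.det_transpose (gram v fun i => reflectAlong w (a i)),
      gram_transpose] at d2
    rw [← d1, reflGram, ← d2]
    ring
  -- Sphere case: `u` spans the same plane as the reflected frame, since both are orthogonal to the
  -- radius in the `(m+1)`-space. The determinant between them is `±1`, and the orientation
  -- condition forces `-1`.
  · rw [det_gram_radial ha hxy hcE hca hc huE huc] at hpos
    obtain ⟨hON, hspan⟩ := span_reflected_frame ha hxy hcE hca hc
    have hyc : y ≠ c := by
      rintro rfl
      rw [dist_self] at hc
      exact hxy (dist_eq_zero.1 hc)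
    have hmem : ∀ i, u i ∈ Submodule.span ℝ (range fun i => reflectAlong w (a i)) := by
      intro i
      have hi := huE i
      rw [← hspan] at hi
      obtain ⟨k, hk⟩ := (Submodule.mem_span_range_iff_exists_fun ℝ).1 hi
      have h0 : k 0 = 0 := by
        rw [← hON.inner_right_fintype k 0, hk, Fin.cons_zero, inner_smul_left, real_inner_comm, huc,
          mul_zero]
      rw [Fin.sum_univ_succ, h0, zero_smul, zero_add] at hk
      rw [← hk]
      exact Submodule.sum_mem _ fun j _ => Submodule.smul_mem _ _
        (Submodule.subset_span ⟨j, rfl⟩)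
    have hsq := det_gram_sq_eq_one hR huON hmem
    have hneg : (reflGram w a u).det < 0 := by
      by_contra hcon
      push Not at hcon
      have : 0 ≤ ‖y - c‖ ^ 2 * (reflGram w a u).det := by positivity
      linarith
    have h1 : (gram (fun i => reflectAlong w (a i)) u).det = -1 := by
      change (reflGram w a u).det ^ 2 = 1 at hsq
      change (reflGram w a u).det = -1
      nlinarith
    have d1 := congrArg Matrix.det (gram_mul_gram hR v u hmem)
    rw [Matrix.det_mul, h1, ← Matrix.det_transpose (gram v u), gram_transpose,
      ← Matrix.det_transpose (gram v fun i => _), gram_transpose] at d1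
    rw [← d1, reflGram]
    ring

theorem det_gram_update_neg (b : Fin m → Eu n) (hb : Orthonormal ℝ b) (i₀ : Fin m) :
    (gram b (Function.update b i₀ (-b i₀))).det = -1 := by
  have : gram b (Function.update b i₀ (-b i₀)) = (1 : Matrix (Fin m) (Fin m) ℝ).updateCol i₀
      ((-1 : ℝ) • (1 : Matrix (Fin m) (Fin m) ℝ).col i₀) := by
    rw [← gram_self_eq_one hb]
    ext i j
    by_cases hj : j = i₀
    · subst hj; simp
    · simp [hj]
  rw [this, Matrix.det_updateCol_smul]
  have h2 : (1 : Matrix (Fin m) (Fin m) ℝ).updateCol i₀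
      ((1 : Matrix (Fin m) (Fin m) ℝ).col i₀) = 1 := by
    ext i j
    by_cases hj : j = i₀
    · subst hj; simp
    · simp [hj]
  rw [h2]; simp

/-- Existence ensures that the `epsilon` in `cosCombinedAngle` picks a genuine value. On a round
sphere the reflected frame is tangent but has the wrong orientation, so one of its vectors,
available because `1 ≤ m`, is negated. -/
theorem exists_isPosSphereFrame (hm : 1 ≤ m) {x y : Eu n} {a : Fin m → Eu n} (ha : Orthonormal ℝ a)
    (hxy : x ≠ y) : ∃ u, IsPosSphereFrame x a y u := by
  by_cases hyx : y - x ∈ Submodule.span ℝ (range a)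
  · refine ⟨a, ha, Or.inl ⟨hyx, fun i => Submodule.subset_span (mem_range_self i), ?_⟩⟩
    rw [gram_self_eq_one ha]; simp
  set w := ‖y - x‖⁻¹ • (y - x) with hw
  have hw1 : ‖w‖ = 1 := norm_unitDir hxy
  have hR := orthonormal_reflectAlong hw1 ha
  set E := Submodule.span ℝ (insert (y - x) (range a)) with hE
  have hyxE : y - x ∈ E := Submodule.subset_span (mem_insert _ _)
  have haE : ∀ i, a i ∈ E := fun i => Submodule.subset_span (mem_insert_of_mem _ (mem_range_self i))
  set p : Eu n := ∑ i, inner ℝ (a i) (y - x) • a i with hp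
  set ν : Eu n := y - x - p with hν
  have hpa : p ∈ Submodule.span ℝ (range a) := Submodule.sum_mem _ fun i _ =>
    Submodule.smul_mem _ _ (Submodule.subset_span (mem_range_self i))
  have hν0 : ν ≠ 0 := by
    intro h
    rw [hν, sub_eq_zero] at h
    exact hyx (h ▸ hpa)
  have hνa : ∀ i, inner ℝ (a i) ν = (0 : ℝ) := fun i => by
    rw [hν, inner_sub_right, hp, ha.inner_right_fintype, sub_self]
  have hνp : inner ℝ p ν = (0 : ℝ) := by
    rw [hp, sum_inner]
    exact Finset.sum_eq_zero fun i _ => by rw [inner_smul_left, hνa, mul_zero]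
  have hνyx : inner ℝ (y - x) ν = ‖ν‖ ^ 2 := by
    have : y - x = ν + p := by rw [hν]; abel
    rw [this, inner_add_left, hνp, add_zero, real_inner_self_eq_norm_sq]
  have hνE : ν ∈ E := E.sub_mem hyxE (Submodule.sum_mem _ fun i _ => E.smul_mem _ (haE i))
  have hνn : ‖ν‖ ≠ 0 := norm_ne_zero_iff.2 hν0
  -- The centre is `x + t • ν`, with `ν` the normal part of `y - x`. Equidistance reads `‖y - x‖ ^ 2
  -- = 2 t ⟨y - x, ν⟩ = 2 t ‖ν‖ ^ 2`.
  set t : ℝ := ‖y - x‖ ^ 2 / (2 * ‖ν‖ ^ 2) with ht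
  set c : Eu n := x + t • ν with hcdef
  have hcx : c - x = t • ν := by rw [hcdef]; abel
  have hcE : c - x ∈ E := by rw [hcx]; exact E.smul_mem _ hνE
  have hca : ∀ i, inner ℝ (a i) (c - x) = (0 : ℝ) := fun i => by
    rw [hcx, inner_smul_right, hνa, mul_zero]
  have hc : dist x c = dist y c := by
    have h1 : dist x c ^ 2 = dist y c ^ 2 := by
      rw [dist_eq_norm, dist_eq_norm]
      have e1 : y - c = (y - x) - t • ν := by rw [hcdef]; abel
      have e2 : x - c = - (t • ν) := by rw [hcdef]; abel
      rw [e1, e2, norm_neg, norm_sub_sq_real, inner_smul_right, hνyx, ht]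
      field_simp
      ring
    exact (pow_left_inj₀ dist_nonneg dist_nonneg two_ne_zero).1 h1
  set i₀ : Fin m := ⟨0, hm⟩
  set b : Fin m → Eu n := fun i => reflectAlong w (a i) with hb
  set u : Fin m → Eu n := Function.update b i₀ (-b i₀) with hu
  have hu' : ∀ i, u i = b i ∨ u i = -b i := fun i => by
    by_cases hi : i = i₀
    · subst hi; right; simp [hu]
    · left; simp [hu, hi]
  have hyc : y ≠ c := by
    intro h
    rw [h, dist_self] at hc
    exact hxy ((dist_eq_zero.1 hc).trans h.symm)
  have hbE : ∀ i, b i ∈ E := fun i => E.sub_mem (haE i) (E.smul_mem _ (E.smul_mem _ hyxE))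
  have hbc : ∀ i, inner ℝ (b i) (y - c) = (0 : ℝ) := fun i => by
    rw [hb, ← inner_reflectAlong hw1, reflectAlong_reflectAlong hw1, reflectAlong_centre hxy hc,
      ← neg_sub c x, inner_neg_right, hca, neg_zero]
  have huE : ∀ i, u i ∈ E := fun i => by
    rcases hu' i with h | h <;> rw [h]
    exacts [hbE i, E.neg_mem (hbE i)]
  have huc : ∀ i, inner ℝ (u i) (y - c) = (0 : ℝ) := fun i => by
    rcases hu' i with h | h <;> rw [h]
    exacts [hbc i, by rw [inner_neg_left, hbc, neg_zero]]
  have huON : Orthonormal ℝ u := by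
    refine ⟨fun i => ?_, fun i j hij => ?_⟩
    · rcases hu' i with h | h <;> rw [h]
      exacts [hR.1 i, by rw [norm_neg]; exact hR.1 i]
    · have h0 : inner ℝ (b i) (b j) = (0 : ℝ) := hR.2 hij
      rcases hu' i with h | h <;> rcases hu' j with h' | h' <;> simp only [h, h', inner_neg_left,
        inner_neg_right, h0, neg_zero]
  refine ⟨u, huON, Or.inr ⟨hyx, c, hcE, hca, hc, huE, huc, ?_⟩⟩
  rw [det_gram_radial ha hxy hcE hca hc huE huc, reflGram, det_gram_update_neg _ hR]
  have : 0 < ‖y - c‖ := norm_pos_iff.2 (sub_ne_zero.2 hyc)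
  have : 0 < ‖y - c‖ ^ 2 := by positivity
  linarith

end Sphere

/-! ### The angle kernel: frame independence, continuity and special directions -/

section Kernel

variable {m n : ℕ}

/-- The number `det (⟨R a' i, b' j⟩)` for orthonormal frames `a'` and `b'` that span the same oriented
planes as the frames `a` and `b`, where `R` is the reflection along `w`. -/
def angleKernel (a b : Fin m → Eu n) (w : Eu n) : ℝ :=
  (reflGram w a b).det / √((gram a a).det * (gram b b).det)

theorem reflGram_linearComb (w : Eu n) (a b : Fin m → Eu n) (Φ Ψ : Matrix (Fin m) (Fin m) ℝ) :
    reflGram w (fun i => ∑ k, Φ k i • a k) (fun j => ∑ l, Ψ l j • b l) =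
      Φ.transpose * reflGram w a b * Ψ := by
  ext i j
  simp only [reflGram_apply, Matrix.mul_apply, Matrix.transpose_apply, sum_inner, inner_sum,
    inner_smul_left, inner_smul_right, conj_trivial]
  simp only [Finset.sum_mul, Finset.mul_sum]
  rw [← Finset.sum_sub_distrib]
  refine Finset.sum_congr rfl fun l _ => ?_
  rw [← Finset.sum_sub_distrib]
  exact Finset.sum_congr rfl fun k _ => by ring

theorem gram_linearComb (a b : Fin m → Eu n) (Φ Ψ : Matrix (Fin m) (Fin m) ℝ) :
    gram (fun i => ∑ k, Φ k i • a k) (fun j => ∑ l, Ψ l j • b l) =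
      Φ.transpose * gram a b * Ψ := by
  have h : ∀ c d : Fin m → Eu n, gram c d = reflGram 0 c d := fun c d => by
    ext i j; simp [reflGram_apply]
  rw [h, h, reflGram_linearComb]

/-- Orthonormality of `a'` and `b'` gives `(det Φ) ^ 2 * det (gram a a) = 1`, and likewise for `Ψ`,
so the square root in the kernel equals `1 / |det Φ * det Ψ|`. The signs `s` and `t` remove the
absolute value. -/
theorem det_reflGram_eq_angleKernel (w : Eu n) {a b a' b' : Fin m → Eu n}
    (ha' : Orthonormal ℝ a') (hb' : Orthonormal ℝ b') {Φ Ψ : Matrix (Fin m) (Fin m) ℝ}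
    (hΦ : ∀ i, a' i = ∑ k, Φ k i • a k) (hΨ : ∀ i, b' i = ∑ k, Ψ k i • b k)
    {s t : ℝ} (hs : s ^ 2 = 1) (ht : t ^ 2 = 1) (hsΦ : 0 < s * Φ.det) (htΨ : 0 < t * Ψ.det) :
    (reflGram w a' b').det = s * t * angleKernel a b w := by
  obtain rfl : a' = fun i => ∑ k, Φ k i • a k := funext hΦ
  obtain rfl : b' = fun i => ∑ k, Ψ k i • b k := funext hΨ
  have h1 := congrArg Matrix.det (gram_self_eq_one ha')
  have h2 := congrArg Matrix.det (gram_self_eq_one hb')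
  rw [gram_linearComb, Matrix.det_mul, Matrix.det_mul, Matrix.det_transpose, Matrix.det_one]
    at h1 h2
  rw [reflGram_linearComb, Matrix.det_mul, Matrix.det_mul, Matrix.det_transpose, angleKernel]
  set α := (gram a a).det
  set β := (gram b b).det
  set p := Φ.det
  set q := Ψ.det
  have hsq : (s * p * (t * q)) ^ 2 * (α * β) = 1 := by
    calc _ = s ^ 2 * t ^ 2 * ((p * α * p) * (q * β * q)) := by ring
      _ = 1 := by rw [hs, ht, h1, h2]; norm_num
  have hpq : 0 < s * p * (t * q) := mul_pos hsΦ htΨ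
  have hsqrt : √(α * β) = (s * p * (t * q))⁻¹ := by
    rw [Real.sqrt_eq_iff_mul_self_eq_of_pos (inv_pos.2 hpq), ← sq, inv_pow]
    exact (eq_inv_of_mul_eq_one_right hsq).symm
  rw [hsqrt, div_inv_eq_mul]
  calc p * (reflGram w a b).det * q = s ^ 2 * t ^ 2 * (p * (reflGram w a b).det * q) := by
        rw [hs, ht]; ring
    _ = _ := by ring

/-- The images of the standard basis vectors. -/
def stdFrame (A : Eu m →L[ℝ] Eu n) : Fin m → Eu n := fun i => A (EuclideanSpace.single i 1)

theorem continuous_stdFrame : Continuous (stdFrame : (Eu m →L[ℝ] Eu n) → _) :=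
  continuous_pi fun _ => continuous_id.clm_apply continuous_const

theorem apply_eq_sum_stdFrame (A : Eu m →L[ℝ] Eu n) (z : Eu m) :
    A z = ∑ k, z k • stdFrame A k := by
  conv_lhs => rw [← (EuclideanSpace.basisFun (Fin m) ℝ).sum_repr z]
  simp [stdFrame]

theorem orthonormal_stdFrame (L : Eu m →ₗᵢ[ℝ] Eu n) :
    Orthonormal ℝ (stdFrame L.toContinuousLinearMap) := by
  have := (EuclideanSpace.basisFun (Fin m) ℝ).orthonormal.comp_linearIsometry L
  convert this using 1
  ext i
  simp [stdFrame]

theorem span_stdFrame (A : Eu m →L[ℝ] Eu n) :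
    Submodule.span ℝ (range (stdFrame A)) = LinearMap.range A.toLinearMap := by
  apply le_antisymm
  · rw [Submodule.span_le]
    rintro _ ⟨i, rfl⟩
    exact ⟨_, rfl⟩
  · rintro _ ⟨z, rfl⟩
    change A z ∈ _
    rw [apply_eq_sum_stdFrame]
    exact Submodule.sum_mem _ fun i _ => Submodule.smul_mem _ _
      (Submodule.subset_span (mem_range_self i))

theorem continuous_det_reflGram {X : Type*} [TopologicalSpace X] {a b : X → Fin m → Eu n}
    {w : X → Eu n} (ha : Continuous a) (hb : Continuous b) (hw : Continuous w) :
    Continuous fun x => (reflGram (w x) (a x) (b x)).det := by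
  refine Continuous.matrix_det (continuous_matrix fun i j => ?_)
  simp only [reflGram_apply]
  have h1 := (continuous_apply i).comp ha
  have h2 := (continuous_apply j).comp hb
  exact (h1.inner h2).sub ((continuous_const.mul (h1.inner hw)).mul (hw.inner h2))

theorem continuous_det_gram {X : Type*} [TopologicalSpace X] {a b : X → Fin m → Eu n}
    (ha : Continuous a) (hb : Continuous b) : Continuous fun x => (gram (a x) (b x)).det := by
  refine Continuous.matrix_det (continuous_matrix fun i j => ?_)
  exact ((continuous_apply i).comp ha).inner ((continuous_apply j).comp hb)

/-- Bounds for the kernel that hold on a compact set of directions persist nearby. -/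
theorem exists_angleKernel_mem_Ioo (LA LB : Eu m →ₗᵢ[ℝ] Eu n) {S : Set (Eu n)} (hS : IsCompact S)
    {lo hi : ℝ} (h : ∀ w ∈ S, (reflGram w (stdFrame LA.toContinuousLinearMap)
      (stdFrame LB.toContinuousLinearMap)).det ∈ Ioo lo hi) :
    ∃ δ > 0, ∀ (A B : Eu m →L[ℝ] Eu n) (w w₀ : Eu n), ‖A - LA.toContinuousLinearMap‖ < δ →
      ‖B - LB.toContinuousLinearMap‖ < δ → w₀ ∈ S → ‖w - w₀‖ < δ →
      angleKernel (stdFrame A) (stdFrame B) w ∈ Ioo lo hi := by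
  let X := (Eu m →L[ℝ] Eu n) × (Eu m →L[ℝ] Eu n) × Eu n
  let N : X → ℝ := fun x => (reflGram x.2.2 (stdFrame x.1) (stdFrame x.2.1)).det
  let Q : X → ℝ := fun x => (gram (stdFrame x.1) (stdFrame x.1)).det *
    (gram (stdFrame x.2.1) (stdFrame x.2.1)).det
  have cA : Continuous fun x : X => stdFrame x.1 := continuous_stdFrame.comp continuous_fst
  have cB : Continuous fun x : X => stdFrame x.2.1 :=
    continuous_stdFrame.comp (continuous_fst.comp continuous_snd)
  have cN : Continuous N := continuous_det_reflGram cA cB (continuous_snd.comp continuous_snd)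
  have cQ : Continuous Q := (continuous_det_gram cA cA).mul (continuous_det_gram cB cB)
  -- The two bounds are cleared of the denominator, so openness is just continuity. At the
  -- isometries themselves `Q = 1`, and compactness supplies a uniform thickening.
  let O : Set X := {x | 0 < Q x} ∩ ({x | lo * √(Q x) < N x} ∩ {x | N x < hi * √(Q x)})
  have hO : IsOpen O := (isOpen_lt continuous_const cQ).inter
    ((isOpen_lt (continuous_const.mul cQ.sqrt) cN).inter
      (isOpen_lt cN (continuous_const.mul cQ.sqrt)))
  let T : Set X := {LA.toContinuousLinearMap} ×ˢ ({LB.toContinuousLinearMap} ×ˢ S)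
  have hT : IsCompact T := isCompact_singleton.prod (isCompact_singleton.prod hS)
  have hTO : T ⊆ O := by
    rintro ⟨A, B, w⟩ ⟨hA, hB, hw⟩
    obtain rfl : A = LA.toContinuousLinearMap := hA
    obtain rfl : B = LB.toContinuousLinearMap := hB
    have hQ1 : Q (LA.toContinuousLinearMap, LB.toContinuousLinearMap, w) = 1 := by
      simp only [Q]
      rw [gram_self_eq_one (orthonormal_stdFrame LA), gram_self_eq_one (orthonormal_stdFrame LB)]
      simp
    have := h w hw
    refine ⟨?_, ?_, ?_⟩
    · simp [hQ1]
    · simpa [hQ1, N] using this.1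
    · simpa [hQ1, N] using this.2
  obtain ⟨δ, hδ, hsub⟩ := hT.exists_thickening_subset_open hO hTO
  refine ⟨δ, hδ, fun A B w w₀ hA hB hw₀ hw => ?_⟩
  have hmem : ((A, B, w) : X) ∈ O := by
    apply hsub
    rw [Metric.mem_thickening_iff]
    refine ⟨(LA.toContinuousLinearMap, LB.toContinuousLinearMap, w₀), ⟨rfl, rfl, hw₀⟩, ?_⟩
    rw [Prod.dist_eq, Prod.dist_eq]
    simp only [dist_eq_norm]
    exact max_lt hA (max_lt hB hw)
  obtain ⟨h0, h1, h2⟩ := hmem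
  have hs : 0 < √(Q (A, B, w)) := Real.sqrt_pos.2 h0
  exact ⟨(lt_div_iff₀ hs).2 h1, (div_lt_iff₀ hs).2 h2⟩

theorem det_reflGram_of_orthogonal {a : Fin m → Eu n} (ha : Orthonormal ℝ a) {w : Eu n}
    (hw : ∀ i, inner ℝ (a i) w = (0 : ℝ)) : (reflGram w a a).det = 1 := by
  have : reflGram w a a = 1 := by
    rw [← gram_self_eq_one ha]
    ext i j
    simp [reflGram_apply, hw]
  rw [this, Matrix.det_one]

/-- Bessel's inequality: the sum is the squared length of the projection `p` of `x` to the span of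
`b`, and the defect is `‖x - p‖ ^ 2`, which vanishes only if `x` lies in the span. -/
theorem sum_inner_sq_le {b : Fin m → Eu n} (hb : Orthonormal ℝ b) {x : Eu n} (hx : ‖x‖ = 1) :
    ∑ j, inner ℝ x (b j) ^ 2 ≤ (1 : ℝ) ∧
      (x ∉ Submodule.span ℝ (range b) → ∑ j, inner ℝ x (b j) ^ 2 < (1 : ℝ)) := by
  set p : Eu n := ∑ j, inner ℝ x (b j) • b j with hp
  have hxp : inner ℝ x p = ∑ j, inner ℝ x (b j) ^ 2 := by
    rw [hp, inner_sum]
    exact Finset.sum_congr rfl fun j _ => by rw [inner_smul_right, sq]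
  have hpp : inner ℝ p p = ∑ j, inner ℝ x (b j) ^ 2 := by
    rw [hp, hb.inner_sum]
    exact Finset.sum_congr rfl fun j _ => by simp [sq]
  have hd : ‖x - p‖ ^ 2 = 1 - ∑ j, inner ℝ x (b j) ^ 2 := by
    rw [norm_sub_sq_real, hxp, hx, ← real_inner_self_eq_norm_sq p, hpp]
    ring
  refine ⟨by nlinarith [sq_nonneg ‖x - p‖], fun hxs => ?_⟩
  have : 0 < ‖x - p‖ := by
    rw [norm_pos_iff, sub_ne_zero]
    intro hxeq
    apply hxs
    rw [hxeq]
    exact Submodule.sum_mem _ fun i _ => Submodule.smul_mem _ _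
      (Submodule.subset_span (mem_range_self i))
  nlinarith

/-- Hadamard's inequality for the matrix of scalar products of two orthonormal frames of different
planes. -/
theorem abs_det_gram_lt_one {a b : Fin m → Eu n} (ha : Orthonormal ℝ a) (hb : Orthonormal ℝ b)
    (hne : Submodule.span ℝ (range a) ≠ Submodule.span ℝ (range b)) : |(gram a b).det| < 1 := by
  obtain ⟨i₀, hi₀⟩ : ∃ i, a i ∉ Submodule.span ℝ (range b) := by
    by_contra hcon
    push Not at hcon
    refine hne (Submodule.eq_of_le_of_finrank_eq (Submodule.span_le.2 ?_) ?_)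
    · rintro _ ⟨i, rfl⟩; exact hcon i
    · rw [finrank_span_eq_card ha.linearIndependent, finrank_span_eq_card hb.linearIndependent]
  have : Fact (Module.finrank ℝ (Eu m) = m) := ⟨by simp⟩
  let e := EuclideanSpace.basisFun (Fin m) ℝ
  -- Row `i` consists of the coordinates of the projection of `a i` to the plane of `b`. All rows
  -- have length at most `1`, and row `i₀` is strictly shorter.
  let row : Fin m → Eu m := fun i => WithLp.toLp 2 fun j => inner ℝ (a i) (b j)
  have hdet : |(gram a b).det| = |e.toBasis.orientation.volumeForm row| := by
    rw [e.toBasis.orientation.volumeForm_robust' e, Module.Basis.det_apply,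
      ← Matrix.det_transpose]
    congr 2
  rw [hdet]
  refine (e.toBasis.orientation.abs_volumeForm_apply_le row).trans_lt ?_
  have hrow : ∀ i, ‖row i‖ ^ 2 = ∑ j, inner ℝ (a i) (b j) ^ 2 := fun i => by
    rw [EuclideanSpace.norm_sq_eq]
    simp [row]
  have hle : ∀ i, ‖row i‖ ≤ 1 := fun i => by
    have := (sum_inner_sq_le hb (ha.1 i)).1
    rw [← hrow] at this
    nlinarith [norm_nonneg (row i)]
  have hlt : ‖row i₀‖ < 1 := by
    have := (sum_inner_sq_le hb (ha.1 i₀)).2 hi₀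
    rw [← hrow] at this
    nlinarith [norm_nonneg (row i₀)]
  rw [← Finset.mul_prod_erase _ _ (Finset.mem_univ i₀)]
  calc ‖row i₀‖ * ∏ i ∈ Finset.univ.erase i₀, ‖row i‖ ≤ ‖row i₀‖ * 1 := by
        gcongr
        exact Finset.prod_le_one (fun _ _ => norm_nonneg _) fun i _ => hle i
    _ < 1 := by rwa [mul_one]

/-- The reflection along a vector of the plane of `a` maps this plane to itself with determinant
`-1`, so the determinant only changes sign and the bound without reflection applies. -/
theorem abs_det_reflGram_lt_one {a b : Fin m → Eu n} (ha : Orthonormal ℝ a) (hb : Orthonormal ℝ b)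
    (hne : Submodule.span ℝ (range a) ≠ Submodule.span ℝ (range b)) {w : Eu n} (hw : ‖w‖ = 1)
    (hwa : w ∈ Submodule.span ℝ (range a)) : |(reflGram w a b).det| < 1 := by
  have e2 := congrArg Matrix.det <| gram_mul_gram ha b (fun i => reflectAlong w (a i)) fun i =>
    Submodule.sub_mem _ (Submodule.subset_span (mem_range_self i)) (Submodule.smul_mem _ _ hwa)
  have e3 := det_reflGram_self hw ha hwa
  rw [reflGram, ← Matrix.det_transpose, gram_transpose] at e3
  rw [Matrix.det_mul, e3, ← Matrix.det_transpose (gram b fun i => reflectAlong w (a i)),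
    gram_transpose, ← Matrix.det_transpose, gram_transpose] at e2
  rw [reflGram, ← e2, mul_neg_one, abs_neg]
  exact abs_det_gram_lt_one ha hb hne

/-- Over two frames close to the same frame, the kernel is close to `1` in normal directions. -/
theorem exists_angleKernel_normal (L : Eu m →ₗᵢ[ℝ] Eu n) :
    ∃ δ > 0, ∀ (A B : Eu m →L[ℝ] Eu n) (w w₀ : Eu n), ‖A - L.toContinuousLinearMap‖ < δ →
      ‖B - L.toContinuousLinearMap‖ < δ → ‖w₀‖ = 1 → (∀ z, inner ℝ (L z) w₀ = (0 : ℝ)) →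
      ‖w - w₀‖ < δ → 0 ≤ angleKernel (stdFrame A) (stdFrame B) w := by
  have hS : IsCompact {w : Eu n | ‖w‖ = 1 ∧ ∀ z, inner ℝ (L z) w = (0 : ℝ)} := by
    refine (isCompact_sphere (0 : Eu n) 1).of_isClosed_subset ?_ fun w hw => by simpa using hw.1
    have : {w : Eu n | ‖w‖ = 1 ∧ ∀ z, inner ℝ (L z) w = (0 : ℝ)} =
        {w | ‖w‖ = 1} ∩ ⋂ z, {w | inner ℝ (L z) w = (0 : ℝ)} := by
      ext w; simp
    rw [this]
    exact (isClosed_eq continuous_norm continuous_const).inter (isClosed_iInter fun z =>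
      isClosed_eq (continuous_const.inner continuous_id) continuous_const)
  obtain ⟨δ, hδ, h⟩ := exists_angleKernel_mem_Ioo L L hS (lo := 0) (hi := 2) fun w hw => by
    rw [det_reflGram_of_orthogonal (orthonormal_stdFrame L) fun i => hw.2 _]
    norm_num
  exact ⟨δ, hδ, fun A B w w₀ hA hB h1 h2 hw => (h A B w w₀ hA hB ⟨h1, h2⟩ hw).1.le⟩

/-- Over two frames close to the same frame, the kernel is close to `-1` in tangent directions. -/
theorem exists_angleKernel_tangent (L : Eu m →ₗᵢ[ℝ] Eu n) {e : Eu m} (he : ‖e‖ = 1) :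
    ∃ δ > 0, ∀ (A B : Eu m →L[ℝ] Eu n) (w : Eu n), ‖A - L.toContinuousLinearMap‖ < δ →
      ‖B - L.toContinuousLinearMap‖ < δ → ‖w - L e‖ < δ →
      angleKernel (stdFrame A) (stdFrame B) w ≤ 0 := by
  obtain ⟨δ, hδ, h⟩ := exists_angleKernel_mem_Ioo L L (isCompact_singleton (x := L e)) (lo := -2)
    (hi := 0) fun w hw => by
      obtain rfl : w = L e := hw
      rw [det_reflGram_self (by rw [L.norm_map, he]) (orthonormal_stdFrame L)
        (by rw [span_stdFrame]; exact ⟨e, rfl⟩)]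
      norm_num
  exact ⟨δ, hδ, fun A B w hA hB hw => (h A B w _ hA hB rfl hw).2.le⟩

/-- Over frames close to frames of different planes, the kernel is bounded away from `±1` in
directions tangent to one of them. -/
theorem exists_angleKernel_transversal (LA LB : Eu m →ₗᵢ[ℝ] Eu n)
    (hne : LinearMap.range LA.toLinearMap ≠ LinearMap.range LB.toLinearMap)
    {e : Eu m} (he : ‖e‖ = 1) :
    ∃ κ > 0, ∃ δ > 0, ∀ (A B : Eu m →L[ℝ] Eu n) (w : Eu n), ‖A - LA.toContinuousLinearMap‖ < δ →
      ‖B - LB.toContinuousLinearMap‖ < δ → ‖w - LA e‖ < δ →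
      |angleKernel (stdFrame A) (stdFrame B) w| ≤ 1 - κ := by
  have hlt := abs_det_reflGram_lt_one (orthonormal_stdFrame LA) (orthonormal_stdFrame LB)
    (by rw [span_stdFrame, span_stdFrame]; exact hne) (w := LA e) (by rw [LA.norm_map, he])
    (by rw [span_stdFrame]; exact ⟨e, rfl⟩)
  obtain ⟨c, hc1, hc2⟩ := exists_between hlt
  obtain ⟨δ, hδ, h⟩ := exists_angleKernel_mem_Ioo LA LB (isCompact_singleton (x := LA e)) (lo := -c)
    (hi := c) fun w hw => by
      obtain rfl : w = LA e := hw
      exact abs_lt.1 hc1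
  refine ⟨1 - c, by linarith, δ, hδ, fun A B w hA hB hw => ?_⟩
  have := h A B w _ hA hB rfl hw
  rw [sub_sub_cancel]
  exact (abs_lt.2 this).le

end Kernel

/-! ### Nearly flat sheets, volume bounds and the transversal case -/

section Sheets

variable {m n : ℕ}

/-- On the ball of radius `r` the map `G` with derivative `D` is `C^1` close, at scale `r`, to the
isometric parametrization `z ↦ q + L z` of an `m`-plane. -/
structure NearlyFlat (L : Eu m →ₗᵢ[ℝ] Eu n) (q : Eu n) (r ε : ℝ) (G : Eu m → Eu n)
    (D : Eu m → Eu m →L[ℝ] Eu n) : Prop where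
  hasFDerivAt : ∀ z ∈ Metric.ball 0 r, HasFDerivAt G (D z) z
  norm_sub_le : ∀ z ∈ Metric.ball 0 r, ‖D z - L.toContinuousLinearMap‖ ≤ ε
  norm_base_le : ‖G 0 - q‖ ≤ ε * r

namespace NearlyFlat

variable {L : Eu m →ₗᵢ[ℝ] Eu n} {q : Eu n} {r ε : ℝ} {G : Eu m → Eu n}
  {D : Eu m → Eu m →L[ℝ] Eu n}

theorem norm_image_sub_le (h : NearlyFlat L q r ε G D) {z z' : Eu m} (hz : z ∈ Metric.ball 0 r)
    (hz' : z' ∈ Metric.ball 0 r) : ‖G z - G z' - L (z - z')‖ ≤ ε * ‖z - z'‖ :=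
  (convex_ball (0 : Eu m) r).norm_image_sub_le_of_norm_hasFDerivWithin_le'
    (φ := L.toContinuousLinearMap) (fun w hw => (h.hasFDerivAt w hw).hasFDerivWithinAt)
    h.norm_sub_le hz' hz

/-- The isometry `L` loses no length and the error is at most half of `‖z - z'‖`. So `G` is
injective with a `2`-Lipschitz inverse. -/
theorem norm_sub_le_two_mul (h : NearlyFlat L q r ε G D) (hε : ε ≤ 1 / 2) {z z' : Eu m}
    (hz : z ∈ Metric.ball 0 r) (hz' : z' ∈ Metric.ball 0 r) : ‖z - z'‖ ≤ 2 * ‖G z - G z'‖ := by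
  have h1 := h.norm_image_sub_le hz hz'
  have h2 : ‖L (z - z')‖ ≤ ‖G z - G z'‖ + ‖G z - G z' - L (z - z')‖ := by
    rw [← norm_sub_rev (L (z - z'))]
    calc ‖L (z - z')‖ = ‖(G z - G z') + (L (z - z') - (G z - G z'))‖ := by congr 1; abel
      _ ≤ _ := norm_add_le _ _
  rw [L.norm_map] at h2
  nlinarith [norm_nonneg (z - z')]

theorem injOn (h : NearlyFlat L q r ε G D) (hε : ε ≤ 1 / 2) : InjOn G (Metric.ball 0 r) := by
  intro z hz z' hz' heq
  have := h.norm_sub_le_two_mul hε hz hz'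
  rw [heq, sub_self, norm_zero, mul_zero] at this
  exact sub_eq_zero.1 (norm_le_zero_iff.1 this)

theorem norm_offset_le (h : NearlyFlat L q r ε G D) (hr : 0 < r) (hε : 0 ≤ ε) {z : Eu m}
    (hz : z ∈ Metric.ball 0 r) : ‖G z - q - L z‖ ≤ 2 * ε * r := by
  have h1 := h.norm_image_sub_le hz (Metric.mem_ball_self hr)
  rw [sub_zero] at h1
  have h2 : ‖z‖ < r := by simpa using hz
  calc ‖G z - q - L z‖ = ‖(G z - G 0 - L z) + (G 0 - q)‖ := by congr 1; abel
    _ ≤ ε * ‖z‖ + ε * r := (norm_add_le _ _).trans (add_le_add h1 h.norm_base_le)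
    _ ≤ 2 * ε * r := by nlinarith

end NearlyFlat

/-- The volume of the unit ball of `ℝ^m`. -/
def unitBallVolume (m : ℕ) : ℝ := (volume (Metric.ball (0 : Eu m) 1)).toReal

theorem unitBallVolume_pos : 0 < unitBallVolume m :=
  ENNReal.toReal_pos (Metric.measure_ball_pos _ _ one_pos).ne' measure_ball_lt_top.ne

/-- The inverse of `G` is `2`-Lipschitz and so increases `m`-dimensional Hausdorff measure by a
factor of at most `2 ^ m`; on the parameter space the normalized Hausdorff measure is Lebesgue
measure. -/
theorem NearlyFlat.le_measure_image {L : Eu m →ₗᵢ[ℝ] Eu n} {q : Eu n} {r ε : ℝ} {G : Eu m → Eu n}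
    {D : Eu m → Eu m →L[ℝ] Eu n} (h : NearlyFlat L q r ε G D) (hε : ε ≤ 1 / 2) {z : Eu m} {ρ : ℝ}
    (hρ : 0 ≤ ρ) (hsub : Metric.closedBall z ρ ⊆ Metric.ball 0 r) :
    ENNReal.ofReal ((ρ / 2) ^ m * unitBallVolume m) ≤
      (μHE[m] : Measure (Eu n)) (G '' Metric.closedBall z ρ) := by
  set K := Metric.closedBall z ρ with hK
  have hinj : InjOn G K := (h.injOn hε).mono hsub
  have hinv : Function.invFunOn G K '' (G '' K) = K := hinj.invFunOn_image Subset.rfl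
  have hlip : LipschitzOnWith 2 (Function.invFunOn G K) (G '' K) := by
    refine LipschitzOnWith.of_dist_le_mul ?_
    rintro _ ⟨a, ha, rfl⟩ _ ⟨b, hb, rfl⟩
    rw [hinj.leftInvOn_invFunOn ha, hinj.leftInvOn_invFunOn hb, dist_eq_norm, dist_eq_norm]
    exact h.norm_sub_le_two_mul hε (hsub ha) (hsub hb)
  have h1 := hlip.hausdorffMeasure_image_le (d := (m : ℝ)) (Nat.cast_nonneg m)
  rw [hinv] at h1
  have h2 : (volume K : ℝ≥0∞) ≤ 2 ^ m * (μHE[m] : Measure (Eu n)) (G '' K) := by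
    rw [← EuclideanSpace.euclideanHausdorffMeasure_eq_volume]
    simp only [Measure.euclideanHausdorffMeasure_def, Measure.smul_apply, ENNReal.smul_def,
      smul_eq_mul]
    calc _ ≤ _ := mul_le_mul_right h1 _
      _ = _ := by
        simp only [ENNReal.rpow_natCast]
        push_cast
        ring
  have h3 : volume K = ENNReal.ofReal (ρ ^ m * unitBallVolume m) := by
    rw [hK, Measure.addHaar_closedBall _ _ hρ, unitBallVolume, ENNReal.ofReal_mul (by positivity),
      ENNReal.ofReal_toReal measure_ball_lt_top.ne]
    simp
  rw [h3] at h2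
  have h4 : ENNReal.ofReal ((ρ / 2) ^ m * unitBallVolume m) =
      (2 ^ m)⁻¹ * ENNReal.ofReal (ρ ^ m * unitBallVolume m) := by
    have : (2 ^ m : ℝ≥0∞)⁻¹ = ENNReal.ofReal ((2 ^ m)⁻¹) := by
      rw [ENNReal.ofReal_inv_of_pos (by positivity), ENNReal.ofReal_pow (by norm_num)]
      simp
    rw [this, ← ENNReal.ofReal_mul (by positivity)]
    congr 1
    rw [div_pow]
    ring
  rw [h4]
  calc _ ≤ (2 ^ m)⁻¹ * (2 ^ m * (μHE[m] : Measure (Eu n)) (G '' K)) := mul_le_mul_right h2 _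
    _ = _ := by
      rw [← mul_assoc, ENNReal.inv_mul_cancel (by positivity) (by finiteness), one_mul]

/-- A lower bound for an integral by the contributions of disjoint balls in the parameter domain. -/
theorem NearlyFlat.sum_le_lintegral {L : Eu m →ₗᵢ[ℝ] Eu n} {q : Eu n} {r ε : ℝ} {G : Eu m → Eu n}
    {D : Eu m → Eu m →L[ℝ] Eu n} (h : NearlyFlat L q r ε G D) (hε : ε ≤ 1 / 2)
    {ι : Type*} (I : Finset ι) {z : ι → Eu m} {ρ k : ι → ℝ} (hρ : ∀ i ∈ I, 0 ≤ ρ i)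
    (hk : ∀ i ∈ I, 0 ≤ k i)
    (hsub : ∀ i ∈ I, Metric.closedBall (z i) (ρ i) ⊆ Metric.ball 0 r)
    (hdisj : (I : Set ι).Pairwise fun i j =>
      Disjoint (Metric.closedBall (z i) (ρ i)) (Metric.closedBall (z j) (ρ j)))
    {S : Set (Eu n)} (hS : MapsTo G (Metric.ball 0 r) S) {F : Eu n → ℝ≥0∞}
    (hF : ∀ i ∈ I, ∀ z' ∈ Metric.closedBall (z i) (ρ i), ENNReal.ofReal (k i) ≤ F (G z')) :
    ENNReal.ofReal (∑ i ∈ I, k i * ((ρ i / 2) ^ m * unitBallVolume m)) ≤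
      ∫⁻ y in S, F y ∂(μHE[m] : Measure (Eu n)) := by
  set A : ι → Set (Eu n) := fun i => G '' Metric.closedBall (z i) (ρ i) with hA
  -- With measurable pieces, comparison with a constant and additivity over the disjoint union need
  -- no measurability of the integrand `F`.
  have hmeas : ∀ i ∈ I, MeasurableSet (A i) := fun i hi => by
    refine IsCompact.measurableSet ((isCompact_closedBall _ _).image_of_continuousOn ?_)
    exact fun z' hz' => (h.hasFDerivAt z' (hsub i hi hz')).continuousAt.continuousWithinAt
  have hAdisj : (I : Set ι).PairwiseDisjoint A := by
    intro i hi j hj hij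
    rw [Function.onFun, disjoint_left]
    rintro _ ⟨a, ha, rfl⟩ ⟨b, hb, hab⟩
    obtain rfl := h.injOn hε (hsub j hj hb) (hsub i hi ha) hab
    exact disjoint_left.1 (hdisj hi hj hij) ha hb
  have hAS : (⋃ i ∈ I, A i) ⊆ S := iUnion₂_subset fun i hi => by
    rintro _ ⟨z', hz', rfl⟩
    exact hS (hsub i hi hz')
  have hΩ := (unitBallVolume_pos (m := m)).le
  rw [ENNReal.ofReal_sum_of_nonneg fun i hi => mul_nonneg (hk i hi)
    (mul_nonneg (pow_nonneg (div_nonneg (hρ i hi) two_pos.le) _) hΩ)]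
  calc _ ≤ ∑ i ∈ I, ∫⁻ y in A i, F y ∂(μHE[m] : Measure (Eu n)) := by
        refine Finset.sum_le_sum fun i hi => ?_
        calc _ = ENNReal.ofReal (k i) * ENNReal.ofReal ((ρ i / 2) ^ m * unitBallVolume m) :=
              ENNReal.ofReal_mul (hk i hi)
          _ ≤ ENNReal.ofReal (k i) * (μHE[m] : Measure (Eu n)) (A i) :=
              mul_le_mul_right (h.le_measure_image hε (hρ i hi) (hsub i hi)) _
          _ = ∫⁻ y in A i, ENNReal.ofReal (k i) ∂(μHE[m] : Measure (Eu n)) :=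
              (setLIntegral_const _ _).symm
          _ ≤ _ := setLIntegral_mono' (hmeas i hi) (by rintro _ ⟨z', hz', rfl⟩; exact hF i hi z' hz')
    _ = ∫⁻ y in ⋃ i ∈ I, A i, F y ∂(μHE[m] : Measure (Eu n)) :=
        (lintegral_biUnion_finset hAdisj hmeas _).symm
    _ ≤ _ := lintegral_mono_set hAS

theorem NearlyFlat.le_lintegral {L : Eu m →ₗᵢ[ℝ] Eu n} {q : Eu n} {r ε : ℝ} {G : Eu m → Eu n}
    {D : Eu m → Eu m →L[ℝ] Eu n} (h : NearlyFlat L q r ε G D) (hε : ε ≤ 1 / 2)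
    {z : Eu m} {ρ k : ℝ} (hρ : 0 ≤ ρ) (hk : 0 ≤ k)
    (hsub : Metric.closedBall z ρ ⊆ Metric.ball 0 r)
    {S : Set (Eu n)} (hS : MapsTo G (Metric.ball 0 r) S) {F : Eu n → ℝ≥0∞}
    (hF : ∀ z' ∈ Metric.closedBall z ρ, ENNReal.ofReal k ≤ F (G z')) :
    ENNReal.ofReal (k * ((ρ / 2) ^ m * unitBallVolume m)) ≤
      ∫⁻ y in S, F y ∂(μHE[m] : Measure (Eu n)) := by
  simpa using h.sum_le_lintegral hε ({()} : Finset Unit) (z := fun _ => z) (ρ := fun _ => ρ)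
    (k := fun _ => k) (fun _ _ => hρ) (fun _ _ => hk) (fun _ _ => hsub) (by simp) hS
    (fun _ _ => hF)

/-- Replacing `‖b‖` by `‖a‖` and `b` by `a` costs `‖a - b‖` each. The bound also covers `a = 0`,
where the normalized vector is `0`. -/
theorem norm_normalize_sub_le {E : Type*} [NormedAddCommGroup E] [NormedSpace ℝ E] (a : E) {b : E}
    (hb : b ≠ 0) : ‖‖a‖⁻¹ • a - ‖b‖⁻¹ • b‖ ≤ 2 * ‖a - b‖ / ‖b‖ := by
  have hb' : 0 < ‖b‖ := norm_pos_iff.2 hb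
  have hle : ‖‖a‖⁻¹ • a‖ ≤ 1 := by
    rw [norm_smul, norm_inv, norm_norm]
    exact inv_mul_le_one
  have ha : ‖a‖ • ‖a‖⁻¹ • a = a := by
    by_cases h : a = 0
    · simp [h]
    · rw [smul_inv_smul₀ (norm_ne_zero_iff.2 h)]
  rw [le_div_iff₀ hb']
  calc ‖‖a‖⁻¹ • a - ‖b‖⁻¹ • b‖ * ‖b‖ = ‖‖b‖ • (‖a‖⁻¹ • a - ‖b‖⁻¹ • b)‖ := by
        rw [norm_smul, norm_norm, mul_comm]
    _ = ‖(‖b‖ - ‖a‖) • ‖a‖⁻¹ • a + (a - b)‖ := by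
        rw [sub_smul, ha, smul_sub, smul_inv_smul₀ hb'.ne']
        congr 1; abel
    _ ≤ ‖a - b‖ * 1 + ‖a - b‖ := by
        refine (norm_add_le _ _).trans (add_le_add_left ?_ _)
        rw [norm_smul]
        gcongr
        rw [norm_sub_rev a b]
        exact abs_norm_sub_norm_le b a
    _ = 2 * ‖a - b‖ := by ring

theorem normalize_smul_unit {E : Type*} [NormedAddCommGroup E] [NormedSpace ℝ E] {v : E}
    (hv : ‖v‖ = 1) {t : ℝ} (ht : 0 < t) : ‖t • v‖⁻¹ • t • v = v := by
  rw [norm_smul, hv, mul_one, Real.norm_of_nonneg ht.le, inv_smul_smul₀ (ne_of_gt ht)]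

/-- The double integral of the energy for an arbitrary angle function `c` on a set `S`. -/
def pairEnergy (m : ℕ) {n : ℕ} (S : Set (Eu n)) (c : Eu n → Eu n → ℝ) : ℝ≥0∞ :=
  ∫⁻ x in S, ∫⁻ y in S, ENNReal.ofReal ((1 - c x y) ^ m / dist x y ^ (2 * m))
    ∂(μHE[m] : Measure (Eu n)) ∂(μHE[m] : Measure (Eu n))

/-- Two disjoint nearly flat sheets in `S` whose angle function is given, up to the sign `s`, by the
frames of the parametrizations. -/
structure SheetPair (LA LB : Eu m →ₗᵢ[ℝ] Eu n) (r ε : ℝ) (S : Set (Eu n)) (c : Eu n → Eu n → ℝ)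
    (s : ℝ) (q : Eu n) (GA GB : Eu m → Eu n) (DA DB : Eu m → Eu m →L[ℝ] Eu n) : Prop where
  flatA : NearlyFlat LA q r ε GA DA
  flatB : NearlyFlat LB q r ε GB DB
  mapsA : MapsTo GA (Metric.ball 0 r) S
  mapsB : MapsTo GB (Metric.ball 0 r) S
  ne : ∀ z ∈ Metric.ball 0 r, ∀ z' ∈ Metric.ball 0 r, GA z ≠ GB z'
  angle : ∀ z ∈ Metric.ball 0 r, ∀ z' ∈ Metric.ball 0 r, c (GA z) (GB z') =
    -(s * angleKernel (stdFrame (DA z)) (stdFrame (DB z'))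
      (‖GB z' - GA z‖⁻¹ • (GB z' - GA z)))

/-- Here `D` is the actual distance and `d` an upper bound for it. Positivity of `D` matters:
division by zero gives `0`, not infinity. This is where disjointness of the sheets is used. -/
theorem ofReal_le_integrand {κ d c D : ℝ} (hκ : 0 ≤ κ) (hc : κ ≤ 1 - c) (hD : 0 < D) (hd : D ≤ d) :
    ENNReal.ofReal (κ ^ m / d ^ (2 * m)) ≤ ENNReal.ofReal ((1 - c) ^ m / D ^ (2 * m)) := by
  apply ENNReal.ofReal_le_ofReal
  have : 0 ≤ 1 - c := hκ.trans hc
  gcongr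

/-- Sheets that cross at a positive angle: every scale contributes the same amount of energy. -/
theorem exists_lt_pairEnergy_of_transversal (hm : 1 ≤ m) (LA LB : Eu m →ₗᵢ[ℝ] Eu n)
    (hne : LinearMap.range LA.toLinearMap ≠ LinearMap.range LB.toLinearMap) (C : ℝ≥0) :
    ∃ ε > 0, ∀ r > 0, ∀ S c s q GA GB DA DB, (s = 1 ∨ s = -1) →
      SheetPair LA LB r ε S c s q GA GB DA DB → (C : ℝ≥0∞) < pairEnergy m S c := by
  set e : Eu m := EuclideanSpace.single ⟨0, hm⟩ 1 with he
  have he1 : ‖e‖ = 1 := by simp [he]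
  obtain ⟨κ, hκ, δ, hδ, hker⟩ := exists_angleKernel_transversal LA LB hne he1
  -- Relative size of the balls at each scale. Displacement errors will be at most `3 * τ * R i`,
  -- and normalizing doubles them, hence `6 * τ < δ`; `τ ≤ 1 / 4` keeps balls of different scales
  -- disjoint and distances at most `2 * R i`.
  set τ : ℝ := min (δ / 8) (1 / 4) with hτ
  have hτ0 : 0 < τ := lt_min (by positivity) (by norm_num)
  have hτδ : 6 * τ < δ := by have := min_le_left (δ / 8) (1 / 4); linarith
  have hτ4 : τ ≤ 1 / 4 := min_le_right _ _
  set Ω := unitBallVolume m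
  have hΩ : 0 < Ω := unitBallVolume_pos
  set c₂ : ℝ := κ ^ m * Ω ^ 2 * (τ / 4) ^ (2 * m) with hc₂
  have hc₂0 : 0 < c₂ := by positivity
  obtain ⟨N, hN⟩ := exists_nat_gt ((C : ℝ) / c₂)
  rw [div_lt_iff₀ hc₂0] at hN
  -- The last term makes the deviation from flatness, up to `4 * ε * r`, at most `τ * R i` even at
  -- the smallest of the `N` scales.
  refine ⟨min (min (δ / 2) (1 / 4)) (τ / (4 * 2 ^ N)), by positivity, ?_⟩
  intro r hr S c s q GA GB DA DB hs h
  set ε := min (min (δ / 2) (1 / 4)) (τ / (4 * 2 ^ N)) with hε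
  have hε0 : 0 < ε := by positivity
  have hεδ : ε < δ := by
    have := (min_le_left (min (δ / 2) (1 / 4)) (τ / (4 * 2 ^ N))).trans (min_le_left _ _)
    linarith
  have hε2 : ε ≤ 1 / 2 := by
    have := (min_le_left (min (δ / 2) (1 / 4)) (τ / (4 * 2 ^ N))).trans (min_le_right _ _)
    linarith
  have hεN : ε ≤ τ / (4 * 2 ^ N) := min_le_right _ _
  -- The exponent `i + 1` gives `R i ≤ r / 2`, so the balls around `-(R i) • e` stay inside the
  -- sheet, while `R i ≥ r / 2 ^ N` for `i < N`.
  set R : ℕ → ℝ := fun i => r / 2 ^ (i + 1) with hR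
  have hR0 : ∀ i, 0 < R i := fun i => by positivity
  have hRr : ∀ i, R i ≤ r / 2 := fun i => by
    simp only [hR]
    gcongr
    calc (2 : ℝ) = 2 ^ 1 := by norm_num
      _ ≤ 2 ^ (i + 1) := pow_le_pow_right₀ (by norm_num) (by omega)
  have hRhalf : ∀ i j, i < j → R j ≤ R i / 2 := fun i j hij => by
    simp only [hR]
    rw [div_div, ← pow_succ]
    gcongr
    · norm_num
    · omega
  have hεR : ∀ i < N, 4 * ε * r ≤ τ * R i := fun i hi => by
    have h1 : r / 2 ^ N ≤ R i := by
      simp only [hR]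
      gcongr
      · norm_num
      · omega
    calc 4 * ε * r ≤ 4 * (τ / (4 * 2 ^ N)) * r := by gcongr
      _ = τ * (r / 2 ^ N) := by field_simp
      _ ≤ τ * R i := by gcongr
  have hball : ∀ i z, z ∈ Metric.closedBall (-(R i) • e) (τ * R i) → z ∈ Metric.ball 0 r := by
    intro i z hz
    rw [Metric.mem_closedBall, dist_eq_norm] at hz
    rw [mem_ball_zero_iff]
    have h1 : ‖-(R i) • e‖ = R i := by rw [norm_smul, he1, mul_one, norm_neg,
      Real.norm_of_nonneg (hR0 i).le]
    have h2 : ‖z‖ ≤ ‖z - -(R i) • e‖ + ‖-(R i) • e‖ := by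
      simpa using norm_add_le (z - -(R i) • e) (-(R i) • e)
    nlinarith [hRr i, hR0 i]
  have hball0 : ∀ i z, z ∈ Metric.closedBall (0 : Eu m) (τ * R i) → z ∈ Metric.ball 0 r := by
    intro i z hz
    rw [mem_closedBall_zero_iff] at hz
    rw [mem_ball_zero_iff]
    nlinarith [hRr i, hR0 i]
  have hpt : ∀ i < N, ∀ z ∈ Metric.closedBall (-(R i) • e) (τ * R i),
      ∀ z' ∈ Metric.closedBall (0 : Eu m) (τ * R i),
      ENNReal.ofReal (κ ^ m / (2 * R i) ^ (2 * m)) ≤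
        ENNReal.ofReal ((1 - c (GA z) (GB z')) ^ m / dist (GA z) (GB z') ^ (2 * m)) := by
    intro i hi z hz z' hz'
    have hzr := hball i z hz
    have hzr' := hball0 i z' hz'
    have hA := h.flatA.norm_offset_le hr hε0.le hzr
    have hB := h.flatB.norm_offset_le hr hε0.le hzr'
    have hdiff : ‖(GB z' - GA z) - (R i) • LA e‖ ≤ 3 * τ * R i := by
      have e1 : (GB z' - GA z) - (R i) • LA e =
          (GB z' - q - LB z') - (GA z - q - LA z) + LB z' - LA (z - -(R i) • e) := by
        rw [map_sub, map_smul]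
        module
      rw [Metric.mem_closedBall, dist_eq_norm] at hz
      rw [mem_closedBall_zero_iff] at hz'
      rw [e1]
      calc _ ≤ ‖GB z' - q - LB z'‖ + ‖GA z - q - LA z‖ + ‖LB z'‖ + ‖LA (z - -(R i) • e)‖ := by
            refine (norm_sub_le _ _).trans (add_le_add_left ?_ _)
            refine (norm_add_le _ _).trans (add_le_add_left ?_ _)
            exact norm_sub_le _ _
        _ ≤ 2 * ε * r + 2 * ε * r + τ * R i + τ * R i := by
            rw [LA.norm_map, LB.norm_map]
            gcongr
        _ ≤ 3 * τ * R i := by linarith [hεR i hi]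
    have hLe : ‖LA e‖ = 1 := by rw [LA.norm_map, he1]
    have hRe : (R i) • LA e ≠ 0 := by
      rw [← norm_pos_iff, norm_smul, hLe, Real.norm_of_nonneg (hR0 i).le, mul_one]
      exact hR0 i
    have hRn : ‖(R i) • LA e‖ = R i := by
      rw [norm_smul, hLe, Real.norm_of_nonneg (hR0 i).le, mul_one]
    have hw : ‖‖GB z' - GA z‖⁻¹ • (GB z' - GA z) - LA e‖ < δ := by
      have h1 := norm_normalize_sub_le (GB z' - GA z) hRe
      rw [normalize_smul_unit hLe (hR0 i), hRn] at h1
      refine h1.trans_lt ?_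
      rw [div_lt_iff₀ (hR0 i)]
      nlinarith [hR0 i]
    have hk := hker (DA z) (DB z') _ ((h.flatA.norm_sub_le z hzr).trans_lt hεδ)
      ((h.flatB.norm_sub_le z' hzr').trans_lt hεδ) hw
    refine ofReal_le_integrand hκ.le ?_ (dist_pos.2 (h.ne z hzr z' hzr')) ?_
    · rw [h.angle z hzr z' hzr']
      have := abs_le.1 hk
      rcases hs with rfl | rfl <;> linarith
    · rw [dist_comm, dist_eq_norm]
      have : ‖GB z' - GA z‖ ≤ ‖(GB z' - GA z) - (R i) • LA e‖ + ‖(R i) • LA e‖ := by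
        simpa using norm_add_le ((GB z' - GA z) - (R i) • LA e) ((R i) • LA e)
      rw [hRn] at this
      nlinarith [hR0 i]
  set ℓ : ℕ → ℝ := fun i => κ ^ m / (2 * R i) ^ (2 * m) * ((τ * R i / 2) ^ m * Ω) with hℓ
  have hinner : ∀ i < N, ∀ z ∈ Metric.closedBall (-(R i) • e) (τ * R i),
      ENNReal.ofReal (ℓ i) ≤ ∫⁻ y in S,
        ENNReal.ofReal ((1 - c (GA z) y) ^ m / dist (GA z) y ^ (2 * m))
          ∂(μHE[m] : Measure (Eu n)) := by
    intro i hi z hz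
    exact h.flatB.le_lintegral hε2 (mul_pos hτ0 (hR0 i)).le (by have := hR0 i; positivity)
      (hball0 i) h.mapsB
      (F := fun y => ENNReal.ofReal ((1 - c (GA z) y) ^ m / dist (GA z) y ^ (2 * m)))
      (hpt i hi z hz)
  have houter := h.flatA.sum_le_lintegral hε2 (Finset.range N) (z := fun i => -(R i) • e)
    (ρ := fun i => τ * R i) (k := ℓ) (fun i _ => (mul_pos hτ0 (hR0 i)).le)
    (fun i _ => by have := hR0 i; positivity) (fun i _ => hball i) ?_ h.mapsA
    (F := fun x => ∫⁻ y in S, ENNReal.ofReal ((1 - c x y) ^ m / dist x y ^ (2 * m))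
      ∂(μHE[m] : Measure (Eu n)))
    (fun i hi => hinner i (Finset.mem_range.1 hi))
  · refine lt_of_lt_of_le ?_ houter
    have hsum : ∑ i ∈ Finset.range N, ℓ i * ((τ * R i / 2) ^ m * unitBallVolume m) = N * c₂ := by
      rw [Finset.sum_congr rfl (g := fun _ => c₂), Finset.sum_const, Finset.card_range, nsmul_eq_mul]
      intro i _
      have := hR0 i
      simp only [hℓ, hc₂]
      change κ ^ m / (2 * R i) ^ (2 * m) * ((τ * R i / 2) ^ m * Ω) * ((τ * R i / 2) ^ m * Ω) = _
      have e1 : (τ / 4) ^ (2 * m) = (τ * R i / 2) ^ (2 * m) / (2 * R i) ^ (2 * m) := by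
        rw [← div_pow]; congr 1; field_simp; norm_num
      rw [e1, two_mul m, pow_add (τ * R i / 2)]
      ring
    rw [hsum, ← ENNReal.ofReal_coe_nnreal, ENNReal.ofReal_lt_ofReal_iff_of_nonneg C.coe_nonneg]
    exact hN
  -- Centres are at least `R i / 2` apart, whereas the radii add up to at most `(3 / 8) * R i`.
  · have key : ∀ i j, i < j → Disjoint (Metric.closedBall (-(R i) • e) (τ * R i))
        (Metric.closedBall (-(R j) • e) (τ * R j)) := by
      intro i j hij
      apply Metric.closedBall_disjoint_closedBall
      have h1 := hRhalf i j hij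
      have : dist (-(R i) • e) (-(R j) • e) = R i - R j := by
        rw [dist_eq_norm, ← sub_smul, norm_smul, he1, mul_one, neg_sub_neg, norm_sub_rev,
          Real.norm_of_nonneg]
        linarith [hR0 i]
      rw [this]
      nlinarith [hR0 i, hR0 j]
    intro i _ j _ hij
    rcases lt_or_gt_of_ne hij with h | h
    exacts [key i j h, (key j i h).symm]

end Sheets

/-! ### Tangential sheets: energy at the scale of their distance -/

section Tangential

variable {m n : ℕ}

/-- Over a point of one sheet there is a point of the other one that differs from it by a vector
normal to the common plane, and it is close. -/
theorem SheetPair.exists_normal_point {L : Eu m →ₗᵢ[ℝ] Eu n} {r ε : ℝ} {S : Set (Eu n)}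
    {c : Eu n → Eu n → ℝ} {s : ℝ} {q : Eu n} {GA GB : Eu m → Eu n}
    {DA DB : Eu m → Eu m →L[ℝ] Eu n} (h : SheetPair L L r ε S c s q GA GB DA DB) (hr : 0 < r)
    (hε0 : 0 ≤ ε) (hε : ε ≤ 1 / 24) {z : Eu m} (hz : z ∈ Metric.closedBall 0 (r / 4)) :
    ∃ z₀ ∈ Metric.closedBall (0 : Eu m) (r / 2),
      (∀ v, inner ℝ (L v) (GB z₀ - GA z) = (0 : ℝ)) ∧ ‖GB z₀ - GA z‖ ≤ 8 * ε * r := by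
  set P := ContinuousLinearMap.adjoint L.toContinuousLinearMap with hP
  have hPL : ∀ v, P (L v) = v := fun v => by
    refine ext_inner_left ℝ fun w => ?_
    rw [hP, ContinuousLinearMap.adjoint_inner_right]
    exact L.inner_map_map w v
  have hPn : ∀ v, ‖P v‖ ≤ ‖v‖ := fun v => by
    refine (P.le_opNorm v).trans (mul_le_of_le_one_left (norm_nonneg _) ?_)
    rw [hP, LinearIsometryEquiv.norm_map]
    exact L.norm_toContinuousLinearMap_le
  have hzr : z ∈ Metric.ball 0 r := Metric.closedBall_subset_ball (by linarith) hz
  -- The tangential projection of `GB` is `ε`-close to the identity, so the quantitative inverse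
  -- function theorem shows that its values on the ball of radius `r / 2` cover a ball of radius `(1
  -- - ε) * (r / 2)`. The projection of `GA z` lies there because `‖z‖ ≤ r / 4` and the remaining
  -- error is at most `3 * ε * r`.
  have happ : ApproximatesLinearOn (fun v => P (GB v)) (ContinuousLinearMap.id ℝ (Eu m))
      (Metric.ball 0 r) ⟨ε, hε0⟩ := by
    intro a ha b hb
    have h1 := h.flatB.norm_image_sub_le ha hb
    have h2 : P (GB a) - P (GB b) - (ContinuousLinearMap.id ℝ (Eu m)) (a - b) =
        P (GB a - GB b - L (a - b)) := by
      rw [map_sub P, map_sub P, hPL]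
      rfl
    rw [h2]
    exact (hPn _).trans h1
  let inv : (ContinuousLinearMap.id ℝ (Eu m)).NonlinearRightInverse :=
    { toFun := id, nnnorm := 1, bound' := fun y => by simp, right_inv' := fun y => rfl }
  have hsurj := happ.surjOn_closedBall_of_nonlinearRightInverse inv (b := 0) (ε := r / 2)
    (by positivity) (Metric.closedBall_subset_ball (by linarith))
  have hA := h.flatA.norm_offset_le hr hε0 hzr
  have htarget : P (GA z) ∈ Metric.closedBall (P (GB 0))
      (((inv.nnnorm : ℝ)⁻¹ - ((⟨ε, hε0⟩ : ℝ≥0) : ℝ)) * (r / 2)) := by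
    rw [Metric.mem_closedBall, dist_eq_norm, ← map_sub]
    refine (hPn _).trans ?_
    have e1 : GA z - GB 0 = (GA z - q - L z) - (GB 0 - q) + L z := by abel
    rw [e1]
    rw [mem_closedBall_zero_iff] at hz
    calc _ ≤ ‖GA z - q - L z‖ + ‖GB 0 - q‖ + ‖L z‖ :=
          (norm_add_le _ _).trans (add_le_add_left (norm_sub_le _ _) _)
      _ ≤ 2 * ε * r + ε * r + r / 4 := by
          rw [L.norm_map]
          exact add_le_add (add_le_add hA h.flatB.norm_base_le) hz
      _ ≤ (1 - ε) * (r / 2) := by nlinarith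
      _ = _ := by simp [inv]
  obtain ⟨z₀, hz₀, hz₀P⟩ := hsurj htarget
  have hz₀P : P (GB z₀ - GA z) = 0 := by rw [map_sub, sub_eq_zero]; exact hz₀P
  have hz₀r : z₀ ∈ Metric.ball 0 r := Metric.closedBall_subset_ball (by linarith) hz₀
  have hB := h.flatB.norm_offset_le hr hε0 hz₀r
  refine ⟨z₀, hz₀, fun v => ?_, ?_⟩
  · have := ContinuousLinearMap.adjoint_inner_right L.toContinuousLinearMap v (GB z₀ - GA z)
    rw [← hP, hz₀P, inner_zero_right] at this
    exact this.symm
  -- Flatness bounds `E` by `4 * ε * r`. As the total difference has no tangential part, `L (z₀ -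
  -- z)` cancels the tangential part of `E`, which at most doubles the bound.
  · set E : Eu n := (GB z₀ - q - L z₀) - (GA z - q - L z) with hE
    have hEn : ‖E‖ ≤ 4 * ε * r := (norm_sub_le _ _).trans (by linarith)
    have e1 : GB z₀ - GA z = E + L (z₀ - z) := by rw [map_sub, hE]; abel
    have e2 : z₀ - z = -P E := by
      rw [e1, map_add, hPL] at hz₀P
      exact eq_neg_of_add_eq_zero_right hz₀P
    rw [e1]
    calc _ ≤ ‖E‖ + ‖L (z₀ - z)‖ := norm_add_le _ _
      _ ≤ ‖E‖ + ‖E‖ := by rw [L.norm_map, e2, norm_neg]; exact add_le_add_right (hPn E) _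
      _ ≤ _ := by linarith

/-- Near the normal point of `exists_normal_point` there is, at the scale of the distance, a ball of
parameters over which the angle is obtuse. -/
theorem exists_obtuse_ball (hm : 1 ≤ m) (L : Eu m →ₗᵢ[ℝ] Eu n) {s : ℝ} (hs : s = 1 ∨ s = -1) :
    ∃ ε₁ > 0, ∃ t ≥ 0, ∃ τ > 0, ∃ d > 0, ∃ e : Eu m, ‖e‖ = 1 ∧
      ∀ ε, 0 ≤ ε → ε ≤ ε₁ → ∀ r S c q GA GB DA DB, SheetPair L L r ε S c s q GA GB DA DB →
      ∀ z ∈ Metric.ball 0 r, ∀ z₀ ∈ Metric.ball 0 r,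
        (∀ v, inner ℝ (L v) (GB z₀ - GA z) = (0 : ℝ)) → ∀ z' ∈ Metric.ball 0 r,
        ‖z' - (z₀ + (t * ‖GB z₀ - GA z‖) • e)‖ ≤ τ * ‖GB z₀ - GA z‖ →
        c (GA z) (GB z') ≤ 0 ∧ dist (GA z) (GB z') ≤ d * ‖GB z₀ - GA z‖ := by
  set e : Eu m := EuclideanSpace.single ⟨0, hm⟩ 1 with he
  have he1 : ‖e‖ = 1 := by simp [he]
  have hLe : ‖L e‖ = 1 := by rw [L.norm_map, he1]
  rcases hs with rfl | rfl
  -- For `s = 1` the cosine is minus the kernel, so directions near the normal are needed: the ball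
  -- is centred at `z₀` itself (`t = 0`).
  · obtain ⟨δ', hδ', hker⟩ := exists_angleKernel_normal L
    set δ := min δ' 1 with hδdef
    have hδ : 0 < δ := lt_min hδ' one_pos
    have hδ1 : δ ≤ 1 := min_le_right _ _
    have hδδ' : δ ≤ δ' := min_le_left _ _
    refine ⟨δ / 2, by positivity, 0, le_rfl, δ / 8, by positivity, 2, two_pos, e, he1, ?_⟩
    intro ε hε0 hε r S c q GA GB DA DB h z hz z₀ hz₀ hnormal z' hz' hd
    set u := ‖GB z₀ - GA z‖ with hu
    have hne0 : GB z₀ - GA z ≠ 0 := sub_ne_zero.2 (h.ne z hz z₀ hz₀).symm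
    have hu0 : 0 < u := norm_pos_iff.2 hne0
    rw [zero_mul, zero_smul, add_zero] at hd
    have h1 := h.flatB.norm_image_sub_le hz' hz₀
    have h2 : ‖GB z' - GB z₀‖ ≤ δ / 4 * u := by
      have : ‖GB z' - GB z₀‖ ≤ ‖GB z' - GB z₀ - L (z' - z₀)‖ + ‖L (z' - z₀)‖ := by
        simpa using norm_add_le (GB z' - GB z₀ - L (z' - z₀)) (L (z' - z₀))
      rw [L.norm_map] at this
      nlinarith [norm_nonneg (z' - z₀)]
    have e1 : GB z' - GA z - (GB z₀ - GA z) = GB z' - GB z₀ := by abel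
    have hw : ‖‖GB z' - GA z‖⁻¹ • (GB z' - GA z) - u⁻¹ • (GB z₀ - GA z)‖ < δ' := by
      refine (norm_normalize_sub_le (GB z' - GA z) hne0).trans_lt ?_
      rw [e1, div_lt_iff₀ hu0]
      nlinarith
    have hk := hker (DA z) (DB z') _ _ ((h.flatA.norm_sub_le z hz).trans_lt (by linarith))
      ((h.flatB.norm_sub_le z' hz').trans_lt (by linarith)) (norm_unitDir (h.ne z hz z₀ hz₀))
      (fun v => by rw [inner_smul_right, hnormal, mul_zero]) hw
    refine ⟨by rw [h.angle z hz z' hz']; linarith, ?_⟩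
    rw [dist_comm, dist_eq_norm]
    have : ‖GB z' - GA z‖ ≤ ‖GB z' - GB z₀‖ + u := by
      simpa using norm_add_le (GB z' - GB z₀) (GB z₀ - GA z)
    nlinarith
  · obtain ⟨δ', hδ', hker⟩ := exists_angleKernel_tangent L he1
    set δ := min δ' 1 with hδdef
    have hδ : 0 < δ := lt_min hδ' one_pos
    have hδ1 : δ ≤ 1 := min_le_right _ _
    have hδδ' : δ ≤ δ' := min_le_left _ _
    -- For `s = -1` the cosine is the kernel, so directions near the tangent vector `L e` are
    -- needed. A sideways shift by `K * u` dominates the other displacements, which total at most `3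
    -- * u`; normalizing gives the error `6 / K < δ`.
    set K := 8 / δ with hK
    have hK0 : 0 < K := by positivity
    have hKδ : K * δ = 8 := by rw [hK]; field_simp
    refine ⟨min (δ / 2) (1 / (K + 1)), by positivity, K, hK0.le, 1, one_pos, K + 3, by positivity,
      e, he1, ?_⟩
    intro ε hε0 hε r S c q GA GB DA DB h z hz z₀ hz₀ hnormal z' hz' hd
    have hεδ : ε ≤ δ / 2 := hε.trans (min_le_left _ _)
    have hεK : ε * (K + 1) ≤ 1 := by
      have := hε.trans (min_le_right _ _)
      rwa [le_div_iff₀ (by positivity)] at this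
    set u := ‖GB z₀ - GA z‖ with hu
    have hu0 : 0 < u := norm_pos_iff.2 (sub_ne_zero.2 (h.ne z hz z₀ hz₀).symm)
    rw [one_mul] at hd
    have hKe : ‖(K * u) • e‖ = K * u := by
      rw [norm_smul, he1, mul_one, Real.norm_of_nonneg (by positivity)]
    have hKLe : ‖(K * u) • L e‖ = K * u := by
      rw [norm_smul, hLe, mul_one, Real.norm_of_nonneg (by positivity)]
    have h1 := h.flatB.norm_image_sub_le hz' hz₀
    have hzz : ‖z' - z₀‖ ≤ (K + 1) * u := by
      have : ‖z' - z₀‖ ≤ ‖z' - (z₀ + (K * u) • e)‖ + ‖(K * u) • e‖ := by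
        have e0 : z' - z₀ = (z' - (z₀ + (K * u) • e)) + (K * u) • e := by abel
        conv_lhs => rw [e0]
        exact norm_add_le _ _
      rw [hKe] at this
      linarith
    have h2 : ‖GB z' - GA z - (K * u) • L e‖ ≤ 3 * u := by
      have e1 : GB z' - GA z - (K * u) • L e = (GB z' - GB z₀ - L (z' - z₀)) +
          L (z' - (z₀ + (K * u) • e)) + (GB z₀ - GA z) := by
        simp only [map_sub, map_add, map_smul]
        abel
      rw [e1]
      calc _ ≤ ‖GB z' - GB z₀ - L (z' - z₀)‖ + ‖L (z' - (z₀ + (K * u) • e))‖ + u :=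
            (norm_add_le _ _).trans (add_le_add_left (norm_add_le _ _) _)
        _ ≤ ε * ((K + 1) * u) + u + u := by
            rw [L.norm_map]
            exact add_le_add_left (add_le_add (h1.trans (by gcongr)) hd) _
        _ ≤ 3 * u := by nlinarith
    have hw : ‖‖GB z' - GA z‖⁻¹ • (GB z' - GA z) - L e‖ < δ' := by
      have h3 := norm_normalize_sub_le (GB z' - GA z) (b := (K * u) • L e)
        (by rw [← norm_pos_iff, hKLe]; positivity)
      rw [normalize_smul_unit hLe (by positivity), hKLe] at h3
      refine h3.trans_lt ?_
      rw [div_lt_iff₀ (by positivity)]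
      have : δ * (K * u) = 8 * u := by rw [← mul_assoc, mul_comm δ, hKδ]
      nlinarith [mul_le_mul_of_nonneg_right hδδ' (by positivity : 0 ≤ K * u)]
    have hk := hker (DA z) (DB z') _ ((h.flatA.norm_sub_le z hz).trans_lt (by linarith))
      ((h.flatB.norm_sub_le z' hz').trans_lt (by linarith)) hw
    refine ⟨by rw [h.angle z hz z' hz']; linarith, ?_⟩
    rw [dist_comm, dist_eq_norm]
    have : ‖GB z' - GA z‖ ≤ ‖GB z' - GA z - (K * u) • L e‖ + ‖(K * u) • L e‖ := by
      simpa using norm_add_le (GB z' - GA z - (K * u) • L e) ((K * u) • L e)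
    rw [hKLe] at this
    linarith

/-- Sheets that are tangent to each other, for a given relative orientation: the energy is
concentrated at the scale of the distance of the sheets. -/
theorem exists_lt_pairEnergy_of_tangential_sign (hm : 1 ≤ m) (L : Eu m →ₗᵢ[ℝ] Eu n) (C : ℝ≥0)
    {s : ℝ} (hs : s = 1 ∨ s = -1) :
    ∃ ε₁ > 0, ∀ ε, 0 < ε → ε ≤ ε₁ → ∀ r > 0, ∀ S c q GA GB DA DB,
      SheetPair L L r ε S c s q GA GB DA DB → (C : ℝ≥0∞) < pairEnergy m S c := by
  obtain ⟨ε₁, hε₁, t, ht, τ, hτ, d, hd, e, he, hobt⟩ := exists_obtuse_ball hm L hs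
  set Ω := unitBallVolume m
  have hΩ : 0 < Ω := unitBallVolume_pos
  set c₁ : ℝ := (τ / 2) ^ m * Ω / d ^ (2 * m) with hc₁
  have hc₁0 : 0 < c₁ := by positivity
  -- The bound `1 / 64` makes `(64 * ε) ^ m ≤ 64 * ε`; the bound with `t + τ` keeps the shifted ball
  -- within `r / 4` of `z₀`; the last bound makes the final estimate exceed `C`, with `C + 1` for
  -- strictness and a nonzero denominator.
  refine ⟨min (min ε₁ (1 / 64)) (min (1 / (32 * (t + τ))) (c₁ * Ω / (64 * (C + 1)))),
    by positivity, ?_⟩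
  intro ε hε0 hε r hr S c q GA GB DA DB h
  have hεa : ε ≤ ε₁ := hε.trans ((min_le_left _ _).trans (min_le_left _ _))
  have hεb : ε ≤ 1 / 64 := hε.trans ((min_le_left _ _).trans (min_le_right _ _))
  have hεc : ε * (32 * (t + τ)) ≤ 1 := by
    have := hε.trans ((min_le_right _ _).trans (min_le_left _ _))
    rwa [le_div_iff₀ (by positivity)] at this
  have hεd : ε * (64 * (C + 1)) ≤ c₁ * Ω := by
    have := hε.trans ((min_le_right _ _).trans (min_le_right _ _))
    rwa [le_div_iff₀ (by positivity)] at this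
  have hε2 : ε ≤ 1 / 2 := by linarith
  set k : ℝ := c₁ / (8 * ε * r) ^ m with hk
  have hinner : ∀ z ∈ Metric.closedBall (0 : Eu m) (r / 4), ENNReal.ofReal k ≤ ∫⁻ y in S,
      ENNReal.ofReal ((1 - c (GA z) y) ^ m / dist (GA z) y ^ (2 * m))
        ∂(μHE[m] : Measure (Eu n)) := by
    intro z hz
    have hzr : z ∈ Metric.ball 0 r := Metric.closedBall_subset_ball (by linarith) hz
    obtain ⟨z₀, hz₀, hnormal, hu⟩ := h.exists_normal_point hr hε0.le (by linarith) hz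
    have hz₀r : z₀ ∈ Metric.ball 0 r := Metric.closedBall_subset_ball (by linarith) hz₀
    set u := ‖GB z₀ - GA z‖ with hudef
    have hu0 : 0 < u := norm_pos_iff.2 (sub_ne_zero.2 (h.ne z hzr z₀ hz₀r).symm)
    have hsub : Metric.closedBall (z₀ + (t * u) • e) (τ * u) ⊆ Metric.ball 0 r := by
      intro z' hz'
      rw [Metric.mem_closedBall, dist_eq_norm] at hz'
      rw [mem_closedBall_zero_iff] at hz₀
      rw [mem_ball_zero_iff]
      have h1 : ‖z'‖ ≤ ‖z' - (z₀ + (t * u) • e)‖ + (‖z₀‖ + ‖(t * u) • e‖) := by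
        have e0 : z' = (z' - (z₀ + (t * u) • e)) + (z₀ + (t * u) • e) := by abel
        conv_lhs => rw [e0]
        exact (norm_add_le _ _).trans (add_le_add_right (norm_add_le _ _) _)
      rw [norm_smul, he, mul_one, Real.norm_of_nonneg (by positivity)] at h1
      have h2 : (t + τ) * u ≤ (t + τ) * (8 * ε * r) := by gcongr
      have h3 : (t + τ) * (8 * ε * r) ≤ r / 4 := by nlinarith
      nlinarith
    have hlow := h.flatB.le_lintegral hε2 (z := z₀ + (t * u) • e) (ρ := τ * u)
      (k := 1 ^ m / (d * u) ^ (2 * m)) (by positivity) (by positivity) hsub h.mapsB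
      (F := fun y => ENNReal.ofReal ((1 - c (GA z) y) ^ m / dist (GA z) y ^ (2 * m)))
      (fun z' hz' => by
        have hz'r := hsub hz'
        rw [Metric.mem_closedBall, dist_eq_norm] at hz'
        obtain ⟨h1, h2⟩ := hobt ε hε0.le hεa r S c q GA GB DA DB h z hzr z₀ hz₀r hnormal z' hz'r hz'
        exact ofReal_le_integrand zero_le_one (by linarith) (dist_pos.2 (h.ne z hzr z' hz'r)) h2)
    -- The ball contributes `c₁ / u ^ m`, which decreases in `u`, so `u ≤ 8 * ε * r` gives a bound
    -- independent of `z`.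
    refine le_trans (ENNReal.ofReal_le_ofReal ?_) hlow
    have : 1 ^ m / (d * u) ^ (2 * m) * ((τ * u / 2) ^ m * Ω) = c₁ / u ^ m := by
      rw [hc₁, one_pow, mul_pow d u, two_mul m, pow_add u, mul_div_right_comm τ u, mul_pow (τ / 2) u]
      field_simp
    rw [this, hk]
    gcongr
  have houter := h.flatA.le_lintegral hε2 (z := 0) (ρ := r / 4) (k := k) (by positivity)
    (by positivity) (Metric.closedBall_subset_ball (by linarith)) h.mapsA
    (F := fun x => ∫⁻ y in S, ENNReal.ofReal ((1 - c x y) ^ m / dist x y ^ (2 * m))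
      ∂(μHE[m] : Measure (Eu n))) hinner
  refine lt_of_lt_of_le ?_ houter
  rw [← ENNReal.ofReal_coe_nnreal, ENNReal.ofReal_lt_ofReal_iff_of_nonneg C.coe_nonneg]
  have e1 : k * ((r / 4 / 2) ^ m * Ω) = c₁ * Ω / (64 * ε) ^ m := by
    have : (r / 4 / 2) ^ m = (8 * ε * r) ^ m / (64 * ε) ^ m := by
      rw [← div_pow]; congr 1; field_simp; norm_num
    rw [this, hk]
    field_simp
  change (C : ℝ) < k * ((r / 4 / 2) ^ m * Ω)
  rw [e1, lt_div_iff₀ (by positivity)]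
  have h1 : (64 * ε) ^ m ≤ 64 * ε := pow_le_of_le_one (by positivity) (by linarith) (by omega)
  have hC : (0 : ℝ) ≤ C := C.coe_nonneg
  calc (C : ℝ) * (64 * ε) ^ m ≤ C * (64 * ε) := by gcongr
    _ < c₁ * Ω := by nlinarith

/-- Two nearly flat disjoint sheets that come close to each other carry much energy. -/
theorem exists_lt_pairEnergy (hm : 1 ≤ m) (LA LB : Eu m →ₗᵢ[ℝ] Eu n)
    (hL : LA = LB ∨ LinearMap.range LA.toLinearMap ≠ LinearMap.range LB.toLinearMap) (C : ℝ≥0) :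
    ∃ ε > 0, ∀ r > 0, ∀ S c s q GA GB DA DB, (s = 1 ∨ s = -1) →
      SheetPair LA LB r ε S c s q GA GB DA DB → (C : ℝ≥0∞) < pairEnergy m S c := by
  rcases hL with rfl | hne
  · obtain ⟨ε₁, hε₁, h₁⟩ := exists_lt_pairEnergy_of_tangential_sign hm LA C (Or.inl rfl)
    obtain ⟨ε₂, hε₂, h₂⟩ := exists_lt_pairEnergy_of_tangential_sign hm LA C (Or.inr rfl)
    refine ⟨min ε₁ ε₂, lt_min hε₁ hε₂, fun r hr S c s q GA GB DA DB hs h => ?_⟩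
    rcases hs with rfl | rfl
    · exact h₁ _ (lt_min hε₁ hε₂) (min_le_left _ _) r hr S c q GA GB DA DB h
    · exact h₂ _ (lt_min hε₁ hε₂) (min_le_right _ _) r hr S c q GA GB DA DB h
  · exact exists_lt_pairEnergy_of_transversal hm LA LB hne C

end Tangential

/-! ### Bases obtained from linear bijections -/

section ImageBasis

variable {m : ℕ} {V : Type*} [AddCommGroup V] [Module ℝ V] [FiniteDimensional ℝ V]

/-- The image of the standard basis under a linear bijection. -/
def imageBasis (A : Eu m →ₗ[ℝ] V) (hA : Function.Injective A) (hV : Module.finrank ℝ V = m) :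
    Module.Basis (Fin m) ℝ V :=
  (EuclideanSpace.basisFun (Fin m) ℝ).toBasis.map
    (A.linearEquivOfInjective hA (by rw [hV]; simp))

theorem imageBasis_apply (A : Eu m →ₗ[ℝ] V) (hA : Function.Injective A)
    (hV : Module.finrank ℝ V = m) (i : Fin m) :
    imageBasis A hA hV i = A (EuclideanSpace.single i 1) := by
  simp [imageBasis]

theorem imageBasis_det (A : Eu m →ₗ[ℝ] V) (hA : Function.Injective A)
    (hV : Module.finrank ℝ V = m) (Φ : Matrix (Fin m) (Fin m) ℝ) (β : Fin m → V)
    (h : ∀ i, β i = ∑ k, Φ k i • A (EuclideanSpace.single k 1)) :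
    (imageBasis A hA hV).det β = Φ.det := by
  rw [Module.Basis.det_apply]
  congr 1
  ext k i
  rw [Module.Basis.toMatrix_apply, h i]
  simp only [← imageBasis_apply A hA hV]
  simp [Finsupp.single_apply]

end ImageBasis

/-! ### Orientation signs along a sheet, positive frames and the combined angle -/

section Orientation

variable {m n : ℕ} {M : Type*} [TopologicalSpace M] [ChartedSpace (Eu m) M]

theorem finrank_tangentSpace (p : M) : Module.finrank ℝ (TangentSpace (𝓡 m) p) = m := by
  change Module.finrank ℝ (Eu m) = m
  simp

instance (p : M) : FiniteDimensional ℝ (TangentSpace (𝓡 m) p) :=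
  inferInstanceAs (FiniteDimensional ℝ (Eu m))

/-- The basis of the tangent space that consists of the coordinate vectors of a parametrization. -/
def coordBasis {ψ : Eu m → M} {z : Eu m} (h : Function.Injective (mfderiv (𝓡 m) (𝓡 m) ψ z)) :
    Module.Basis (Fin m) ℝ (TangentSpace (𝓡 m) (ψ z)) :=
  imageBasis (m := m) (mfderiv (𝓡 m) (𝓡 m) ψ z).toLinearMap h (finrank_tangentSpace _)

theorem coordBasis_apply {ψ : Eu m → M} {z : Eu m}
    (h : Function.Injective (mfderiv (𝓡 m) (𝓡 m) ψ z)) (i : Fin m) :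
    coordBasis h i = mfderiv (𝓡 m) (𝓡 m) ψ z (EuclideanSpace.single i 1 : Eu m) :=
  imageBasis_apply _ _ _ _

variable [IsManifold (𝓡 m) 1 M]

/-- Coordinate vectors of a parametrization in terms of a chart. -/
theorem mfderiv_eq_tangentCoordChange {ψ : Eu m → M} {z : Eu m} {p₁ : M}
    (hψ : MDifferentiableAt (𝓡 m) (𝓡 m) ψ z) (hz : ψ z ∈ (chartAt (Eu m) p₁).source) (v : Eu m) :
    mfderiv (𝓡 m) (𝓡 m) ψ z v =
      tangentCoordChange (𝓡 m) p₁ (ψ z) (ψ z) (fderiv ℝ (chartAt (Eu m) p₁ ∘ ψ) z v) := by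
  have h1 : MDifferentiableAt (𝓡 m) (𝓡 m) (chartAt (Eu m) p₁) (ψ z) :=
    mdifferentiableAt_atlas (chart_mem_atlas _ p₁) hz
  rw [← mfderiv_eq_fderiv, mfderiv_comp z h1 hψ, mfderiv_chartAt_eq_tangentCoordChange hz]
  refine Eq.symm ((tangentCoordChange_comp (I := 𝓡 m) (w := ψ z) (x := p₁) (y := ψ z) (z := ψ z)
    (v := mfderiv (𝓡 m) (𝓡 m) ψ z v) ?_).trans (tangentCoordChange_self ?_))
  · simp [hz]
  · simp

/-- The relative orientation of the coordinate vectors of a parametrization is locally constant. -/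
theorem eventually_orientation_iff (o : MfdOrientation m M) {ψ : Eu m → M} {U : Set (Eu m)}
    (hU : IsOpen U) (hψ : ContMDiffOn (𝓡 m) (𝓡 m) 1 ψ U)
    (hinj : ∀ z ∈ U, Function.Injective (mfderiv (𝓡 m) (𝓡 m) ψ z)) {z₁ : Eu m} (hz₁ : z₁ ∈ U) :
    ∀ᶠ z in 𝓝 z₁, ∀ hz : z ∈ U, ((coordBasis (hinj z hz)).orientation = o.at_ (ψ z) ↔
      (coordBasis (hinj z₁ hz₁)).orientation = o.at_ (ψ z₁)) := by
  have hd : ∀ z ∈ U, ContMDiffAt (𝓡 m) (𝓡 m) 1 ψ z := fun z hz =>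
    hψ.contMDiffAt (hU.mem_nhds hz)
  have hsrc : ∀ᶠ z in 𝓝 z₁, ψ z ∈ (chartAt (Eu m) (ψ z₁)).source :=
    (hd z₁ hz₁).continuousAt.eventually
      ((chartAt (Eu m) (ψ z₁)).open_source.mem_nhds (mem_chart_source _ _))
  have hcoord : ContDiffAt ℝ 1 (chartAt (Eu m) (ψ z₁) ∘ ψ) z₁ := by
    rw [← contMDiffAt_iff_contDiffAt]
    exact ContMDiffAt.comp z₁ ((contMDiffOn_chart (I := 𝓡 m) (n := 1)).contMDiffAt
      (chart_source_mem_nhds (Eu m) (ψ z₁))) (hd z₁ hz₁)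
  have hH : ContinuousAt (fderiv ℝ (chartAt (Eu m) (ψ z₁) ∘ ψ)) z₁ :=
    (hcoord.fderiv_right (m := 0) (by simp)).continuousAt
  set H := fderiv ℝ (chartAt (Eu m) (ψ z₁) ∘ ψ) with hHdef
  -- Tangent spaces are copies of `Eu m`, so bases at different points can be compared once written
  -- in the chart at `ψ z₁`; at `z₁` itself that coordinate change is the identity.
  let b₁ : Module.Basis (Fin m) ℝ (Eu m) := coordBasis (hinj z₁ hz₁)
  have hb₁ : ∀ i, b₁ i = H z₁ (EuclideanSpace.single i 1) := fun i => by
    refine (coordBasis_apply (hinj z₁ hz₁) i).trans ?_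
    refine (mfderiv_eq_tangentCoordChange ((hd z₁ hz₁).mdifferentiableAt one_ne_zero)
      (mem_chart_source _ _) _).trans ?_
    exact tangentCoordChange_self (I := 𝓡 m) (x := ψ z₁) (mem_extChartAt_source (ψ z₁))
  have hdet : ∀ᶠ z in 𝓝 z₁, 0 < b₁.det (fun i => H z (EuclideanSpace.single i 1)) := by
    have hc : ContinuousAt (fun z => b₁.det (fun i => H z (EuclideanSpace.single i 1))) z₁ := by
      simp only [Module.Basis.det_apply]
      refine (Continuous.matrix_det continuous_id).continuousAt.comp
        (tendsto_pi_nhds.2 fun i => tendsto_pi_nhds.2 fun j => ?_)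
      have h1 : Continuous fun v : Eu m => b₁.repr v i :=
        LinearMap.continuous_of_finiteDimensional (b₁.coord i)
      exact h1.continuousAt.tendsto.comp (hH.clm_apply continuousAt_const)
    refine hc.eventually (lt_mem_nhds ?_)
    have : (fun i => H z₁ (EuclideanSpace.single i 1)) = b₁ := (funext hb₁).symm
    change 0 < b₁.det fun i => H z₁ (EuclideanSpace.single i 1)
    rw [this, Module.Basis.det_self]
    exact one_pos
  filter_upwards [hsrc, hdet, (hd z₁ hz₁).continuousAt.eventually (o.locallyConst (ψ z₁))]
    with z hzsrc hzdet hzo hz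
  have hmf : ∀ v, mfderiv (𝓡 m) (𝓡 m) ψ z v =
      tangentCoordChange (𝓡 m) (ψ z₁) (ψ z) (ψ z) (H z v) :=
    mfderiv_eq_tangentCoordChange ((hd z hz).mdifferentiableAt one_ne_zero) hzsrc
  have hHinj : Function.Injective (H z) := by
    intro a b hab
    exact hinj z hz (((hmf a).trans (congrArg _ hab)).trans (hmf b).symm)
  let v : Module.Basis (Fin m) ℝ (Eu m) := imageBasis (H z).toLinearMap hHinj (by simp)
  have hv : ∀ i, v i = H z (EuclideanSpace.single i 1) := imageBasis_apply _ _ _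
  -- The coordinate vectors at `z` are the coordinate changes of the chart vectors `v`, so local
  -- constancy of `o` reduces the claim to comparing `v` with `b₁`, where the determinant is
  -- positive by continuity.
  have key := hzo v (coordBasis (hinj z hz)) fun i => by
    exact ((coordBasis_apply _ i).trans (hmf _)).trans (congrArg _ (hv i).symm)
  rw [← key]
  have : b₁.orientation = v.orientation := by
    rw [Module.Basis.orientation_eq_iff_det_pos, show (v : Fin m → Eu m) = _ from funext hv]
    exact hzdet
  exact Eq.congr_left (this.symm)

/-- Over a connected parameter domain, positive bases have a fixed sign relative to the coordinate
vectors. -/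
theorem exists_orientation_sign (o : MfdOrientation m M) {ψ : Eu m → M} {U : Set (Eu m)}
    (hU : IsOpen U) (hUc : IsPreconnected U) (hψ : ContMDiffOn (𝓡 m) (𝓡 m) 1 ψ U)
    (hinj : ∀ z ∈ U, Function.Injective (mfderiv (𝓡 m) (𝓡 m) ψ z)) :
    ∃ s : ℝ, (s = 1 ∨ s = -1) ∧ ∀ z ∈ U,
      ∀ β : Module.Basis (Fin m) ℝ (TangentSpace (𝓡 m) (ψ z)), β.orientation = o.at_ (ψ z) →
      ∀ Φ : Matrix (Fin m) (Fin m) ℝ, (∀ i, β i = ∑ k, Φ k i •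
        mfderiv (𝓡 m) (𝓡 m) ψ z (EuclideanSpace.single k 1 : Eu m)) → 0 < s * Φ.det := by
  classical
  -- Agreement of orientations as a function to the discrete space `Bool`: locally constant on `U`,
  -- hence constant by preconnectedness. The value outside `U` is immaterial.
  let Q : Eu m → Bool := fun z => if hz : z ∈ U then
    decide ((coordBasis (hinj z hz)).orientation = o.at_ (ψ z)) else false
  have hQ : ContinuousOn Q U := by
    intro z₁ hz₁
    refine ContinuousAt.continuousWithinAt (continuousAt_const.congr (f := fun _ => Q z₁) ?_)
    filter_upwards [eventually_orientation_iff o hU hψ hinj hz₁, hU.mem_nhds hz₁] with z hz hzU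
    simp only [Q, hz₁, hzU, dif_pos, decide_eq_decide]
    exact (hz hzU).symm
  by_cases hne : ∃ z₀ ∈ U, (Q z₀ = true)
  · obtain ⟨z₀, hz₀, hQ₀⟩ := hne
    refine ⟨1, Or.inl rfl, fun z hz β hβ Φ hΦ => ?_⟩
    have hQz : Q z = true := (hUc.constant hQ hz hz₀).trans hQ₀
    simp only [Q, hz, dif_pos, decide_eq_true_eq] at hQz
    rw [one_mul, ← imageBasis_det _ (hinj z hz) (finrank_tangentSpace _) Φ β hΦ]
    rw [← hβ, Module.Basis.orientation_eq_iff_det_pos] at hQz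
    exact hQz
  · push Not at hne
    refine ⟨-1, Or.inr rfl, fun z hz β hβ Φ hΦ => ?_⟩
    have hQz := hne z hz
    simp only [Q, hz, dif_pos, ne_eq, decide_eq_true_eq] at hQz
    rw [← hβ, Module.Basis.orientation_eq_iff_det_pos] at hQz
    have h1 : (coordBasis (hinj z hz)).det β = Φ.det :=
      imageBasis_det _ (hinj z hz) (finrank_tangentSpace _) Φ β hΦ
    have h2 : (coordBasis (hinj z hz)).det β ≠ 0 :=
      (Module.Basis.isUnit_det _ β).ne_zero
    rw [h1] at hQz h2
    push Not at hQz
    have := lt_of_le_of_ne hQz h2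
    linarith

variable {g : M → Eu n}

/-- An orthonormal basis of the tangent plane is pulled back along the injective differential and
adjusted to the orientation. The adjustment only changes signs of vectors, so the images remain
orthonormal. -/
theorem exists_isPosFrame (hm : 1 ≤ m) (o : MfdOrientation m M) (p : M)
    (hg : Function.Injective (mfderiv (𝓡 m) (𝓡 n) g p)) : ∃ v, IsPosFrame g o (g p) v := by
  have : Nonempty (Fin m) := ⟨⟨0, hm⟩⟩
  let A : TangentSpace (𝓡 m) p →ₗ[ℝ] Eu n := (mfderiv (𝓡 m) (𝓡 n) g p).toLinearMap
  have hA : Function.Injective A := hg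
  let E := LinearEquiv.ofInjective A hA
  have hfin : Module.finrank ℝ (LinearMap.range A) = m := by
    rw [LinearMap.finrank_range_of_inj hA, finrank_tangentSpace]
  let e := (stdOrthonormalBasis ℝ (LinearMap.range A)).reindex (finCongr hfin)
  let β₀ : Module.Basis (Fin m) ℝ (TangentSpace (𝓡 m) p) := e.toBasis.map E.symm
  let β := β₀.adjustToOrientation (o.at_ p)
  have hAβ₀ : ∀ i, A (β₀ i) = e i := fun i => by
    have : E (β₀ i) = e i := by simp [β₀]
    rw [← this]
    rfl
  have hAβ : ∀ i, A (β i) = e i ∨ A (β i) = -(e i : Eu n) := fun i => by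
    rcases β₀.adjustToOrientation_apply_eq_or_eq_neg (o.at_ p) i with h | h
    · left; rw [← hAβ₀]; exact congrArg A h
    · right; rw [← hAβ₀, ← map_neg]; exact congrArg A h
  have he : Orthonormal ℝ fun i => (e i : Eu n) :=
    e.orthonormal.comp_linearIsometry (LinearMap.range A).subtypeₗᵢ
  refine ⟨fun i => A (β i), ⟨fun i => ?_, fun i j hij => ?_⟩, p, rfl, β,
    β₀.orientation_adjustToOrientation _, fun i => rfl⟩
  · rcases hAβ i with h | h <;> simp only [h]
    exacts [he.1 i, by rw [norm_neg]; exact he.1 i]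
  · have h0 : inner ℝ (e i : Eu n) (e j : Eu n) = (0 : ℝ) := he.2 hij
    rcases hAβ i with h | h <;> rcases hAβ j with h' | h' <;>
      simp only [h, h', inner_neg_left, inner_neg_right, h0, neg_zero]

/-- A positive frame in terms of the coordinate vectors of a parametrization. -/
theorem IsPosFrame.exists_matrix {o : MfdOrientation m M} {ψ : Eu m → M} {z : Eu m} {s : ℝ}
    (hs : ∀ β : Module.Basis (Fin m) ℝ (TangentSpace (𝓡 m) (ψ z)), β.orientation = o.at_ (ψ z) →
      ∀ Φ : Matrix (Fin m) (Fin m) ℝ, (∀ i, β i = ∑ k, Φ k i •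
        mfderiv (𝓡 m) (𝓡 m) ψ z (EuclideanSpace.single k 1 : Eu m)) → 0 < s * Φ.det)
    (hψ : MDifferentiableAt (𝓡 m) (𝓡 m) ψ z) (hψi : Function.Injective (mfderiv (𝓡 m) (𝓡 m) ψ z))
    (hg : MDifferentiableAt (𝓡 m) (𝓡 n) g (ψ z)) (hgi : Function.Injective g) {v : Fin m → Eu n}
    (hv : IsPosFrame g o (g (ψ z)) v) :
    ∃ Φ : Matrix (Fin m) (Fin m) ℝ, 0 < s * Φ.det ∧
      ∀ i, v i = ∑ k, Φ k i • stdFrame (fderiv ℝ (g ∘ ψ) z) k := by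
  obtain ⟨-, p, hp, β, hβ, hvβ⟩ := hv
  -- Injectivity of `g` makes the base point of the frame, and with it the orientation there,
  -- unambiguous.
  obtain rfl : p = ψ z := hgi hp
  let Φ : Matrix (Fin m) (Fin m) ℝ := fun k i => (coordBasis hψi).repr (β i) k
  have hΦ : ∀ i, β i = ∑ k, Φ k i •
      mfderiv (𝓡 m) (𝓡 m) ψ z (EuclideanSpace.single k 1 : Eu m) := fun i => by
    conv_lhs => rw [← (coordBasis hψi).sum_repr (β i)]
    simp only [coordBasis_apply, Φ]
  refine ⟨Φ, hs β hβ Φ hΦ, fun i => ?_⟩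
  rw [hvβ, hΦ, map_sum]
  refine Finset.sum_congr rfl fun k _ => ?_
  rw [map_smul, stdFrame, ← mfderiv_eq_fderiv, mfderiv_comp z hg hψ]
  rfl

/-- The combined angle in terms of parametrizations. -/
theorem cosCombinedAngle_eq (hm : 1 ≤ m) {o : MfdOrientation m M} {x y : Eu n} (hxy : x ≠ y)
    {a b : Fin m → Eu n} {s t : ℝ} (hs : s = 1 ∨ s = -1) (ht : t = 1 ∨ t = -1)
    (hx : ∃ v, IsPosFrame g o x v) (hy : ∃ v, IsPosFrame g o y v)
    (ha : ∀ v, IsPosFrame g o x v → ∃ Φ : Matrix (Fin m) (Fin m) ℝ, 0 < s * Φ.det ∧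
      ∀ i, v i = ∑ k, Φ k i • a k)
    (hb : ∀ v, IsPosFrame g o y v → ∃ Φ : Matrix (Fin m) (Fin m) ℝ, 0 < t * Φ.det ∧
      ∀ i, v i = ∑ k, Φ k i • b k) :
    cosCombinedAngle g o x y =
      -(s * t * angleKernel a b (‖y - x‖⁻¹ • (y - x))) := by
  have hs2 : s ^ 2 = 1 := by rcases hs with rfl | rfl <;> norm_num
  have ht2 : t ^ 2 = 1 := by rcases ht with rfl | rfl <;> norm_num
  obtain ⟨a₀, ha₀⟩ := hx
  obtain ⟨v₀, hv₀⟩ := hy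
  -- One admissible triple of frames must exist before `epsilon` can be unfolded; the triple it then
  -- chooses is irrelevant, since every one gives the same value.
  obtain ⟨u₀, hu₀⟩ := exists_isPosSphereFrame hm ha₀.1 hxy
  obtain ⟨a', u', v', ha', hu', hv', heq⟩ := Classical.epsilon_spec
    (p := fun t : ℝ => ∃ a u v : Fin m → Eu n, IsPosFrame g o x a ∧ IsPosSphereFrame x a y u ∧
      IsPosFrame g o y v ∧ t = (gram u v).det) ⟨_, a₀, u₀, v₀, ha₀, hu₀, hv₀, rfl⟩
  obtain ⟨Φ, hΦ, hΦ'⟩ := ha a' ha'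
  obtain ⟨Ψ, hΨ, hΨ'⟩ := hb v' hv'
  rw [cosCombinedAngle, heq, det_gram_of_isPosSphereFrame ha'.1 hxy hu' v',
    det_reflGram_eq_angleKernel _ ha'.1 hv'.1 hΦ' hΨ' hs2 ht2 hΦ hΨ]

end Orientation

/-! ### The action of diffeomorphisms and openness of the quotient map -/

section Quotient

variable {m n : ℕ} {M : Type*} [TopologicalSpace M] [ChartedSpace (Eu m) M]

theorem injective_mfderiv_diffeomorph (χ : M ≃ₘ^2⟮𝓡 m, 𝓡 m⟯ M) (p : M) :
    Function.Injective (mfderiv (𝓡 m) (𝓡 m) χ p) := by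
  have h := mfderiv_comp p (χ.symm.mdifferentiable two_ne_zero (χ p))
    (χ.mdifferentiable two_ne_zero p)
  have hid : (χ.symm : M → M) ∘ χ = id := funext fun q => χ.symm_apply_apply q
  rw [hid, mfderiv_id] at h
  intro v w hvw
  have hv := DFunLike.congr_fun h v
  have hw := DFunLike.congr_fun h w
  exact hv.trans ((congrArg (mfderiv (𝓡 m) (𝓡 m) χ.symm (χ p)) hvw).trans hw.symm)

/-- Reparametrization of an immersion by a diffeomorphism. -/
def Imm.reparam (χ : M ≃ₘ^2⟮𝓡 m, 𝓡 m⟯ M) (f : Imm m n 2 2 M) : Imm m n 2 2 M :=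
  ⟨f.1.comp χ.toContMDiffMap, fun p => by
    have h := mfderiv_comp p (f.1.contMDiff.mdifferentiable two_ne_zero (χ p))
      (χ.mdifferentiable two_ne_zero p)
    have : Function.Injective (mfderiv (𝓡 m) (𝓡 n) (f.1 ∘ χ) p) := by
      rw [h]
      exact (f.2 (χ p)).comp (injective_mfderiv_diffeomorph χ p)
    exact this⟩

theorem Imm.ext {f g : Imm m n 2 2 M} (h : ∀ p, f p = g p) : f = g :=
  Subtype.ext (ContMDiffMap.ext h)

variable [IsManifold (𝓡 m) 2 M]

theorem chart_comp_diffeomorph_mem (χ : M ≃ₘ^2⟮𝓡 m, 𝓡 m⟯ M) {φ : OpenPartialHomeomorph M (Eu m)}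
    (hφ : φ ∈ IsManifold.maximalAtlas (𝓡 m) 2 M) :
    χ.symm.toHomeomorph.toOpenPartialHomeomorph.trans φ ∈ IsManifold.maximalAtlas (𝓡 m) 2 M := by
  refine OpenPartialHomeomorph.mem_maximalAtlas_of_contMDiffOn (I := 𝓡 m) (n := 2) _ ?_ ?_
  · refine (contMDiffOn_of_mem_maximalAtlas hφ).comp χ.symm.contMDiff.contMDiffOn ?_
    intro p hp
    simpa using hp
  · refine χ.contMDiff.comp_contMDiffOn ((contMDiffOn_symm_of_mem_maximalAtlas hφ).mono ?_)
    intro p hp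
    simpa using hp

/-- Reparametrization permutes the subbasic neighbourhoods. The preimage of the one for `f`, `φ`,
`K` is the one for `f ∘ χ⁻¹`, the chart `φ ∘ χ⁻¹` and the compact set `χ '' K`, because the local
expressions coincide. -/
theorem continuous_reparam (χ : M ≃ₘ^2⟮𝓡 m, 𝓡 m⟯ M) :
    Continuous (Imm.reparam χ : Imm m n 2 2 M → Imm m n 2 2 M) := by
  let _ : TopologicalSpace C^2⟮𝓡 m, M; 𝓡 n, Eu n⟯ := weakTopology 2 2 M (Eu n)
  have hcomp : Continuous
      (fun f : C^2⟮𝓡 m, M; 𝓡 n, Eu n⟯ => f.comp χ.toContMDiffMap) := by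
    refine continuous_generateFrom_iff.2 ?_
    rintro _ ⟨f, φ, ψ, K, ε, hφ, hψ, hK, hKφ, hfK, hε, rfl⟩
    refine TopologicalSpace.isOpen_generateFrom_of_mem ⟨f.comp χ.symm.toContMDiffMap,
      χ.symm.toHomeomorph.toOpenPartialHomeomorph.trans φ, ψ, χ '' K, ε,
      chart_comp_diffeomorph_mem χ hφ, hψ, hK.image χ.continuous, ?_, ?_, hε, ?_⟩
    · rintro _ ⟨p, hp, rfl⟩
      simpa using hKφ hp
    · rintro _ ⟨p, hp, rfl⟩
      change f (χ.symm (χ p)) ∈ ψ.source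
      rw [χ.symm_apply_apply]
      exact hfK hp
    · ext g
      have e1 : (χ.symm.toHomeomorph.toOpenPartialHomeomorph.trans φ) '' (χ '' K) = φ '' K := by
        rw [image_image]
        refine image_congr fun p _ => ?_
        change φ (χ.symm (χ p)) = φ p
        rw [χ.symm_apply_apply]
      have e2 : (ψ ∘ (f.comp χ.symm.toContMDiffMap) ∘
          (χ.symm.toHomeomorph.toOpenPartialHomeomorph.trans φ).symm) = ψ ∘ f ∘ φ.symm := by
        funext z
        change ψ (f (χ.symm (χ (φ.symm z)))) = ψ (f (φ.symm z))
        rw [χ.symm_apply_apply]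
      have e3 : MapsTo g (χ '' K) ψ.source ↔ MapsTo (g.comp χ.toContMDiffMap) K ψ.source := by
        rw [mapsTo_image_iff]
        rfl
      rw [mem_preimage]
      unfold weakNhd
      rw [mem_ofPred_eq, mem_ofPred_eq, e1, e2, e3]
      rfl
  exact continuous_induced_rng.2 (hcomp.comp continuous_induced_dom)

/-- The saturation of an open set is the union of its preimages under all reparametrizations. A
neighbourhood of the parametrization `f` therefore projects to one of the submanifold. -/
theorem isOpenMap_mk :
    IsOpenMap (Quotient.mk (immSetoid m n 2 2 M) : Imm m n 2 2 M → ImmSubmfd m n 2 2 M) := by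
  intro U hU
  have : (Quotient.mk (immSetoid m n 2 2 M)) ⁻¹' (Quotient.mk (immSetoid m n 2 2 M) '' U) =
      ⋃ χ : M ≃ₘ^2⟮𝓡 m, 𝓡 m⟯ M, Imm.reparam χ ⁻¹' U := by
    ext g
    simp only [mem_preimage, mem_image, mem_iUnion]
    constructor
    · rintro ⟨f, hf, hfg⟩
      obtain ⟨χ, hχ⟩ := Quotient.exact hfg.symm
      refine ⟨χ, ?_⟩
      have : Imm.reparam χ g = f := Imm.ext fun p => (hχ p).symm
      rwa [this]
    · rintro ⟨χ, hχ⟩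
      have hg : g ≈ Imm.reparam χ g := ⟨χ, fun p => rfl⟩
      exact ⟨_, hχ, (Quotient.sound hg).symm⟩
  change IsOpen ((Quotient.mk (immSetoid m n 2 2 M)) ⁻¹' _)
  rw [this]
  exact isOpen_iUnion fun χ => (continuous_reparam χ).isOpen_preimage U hU

end Quotient

/-! ### Immersions near `f` in charts adapted to a tangent plane -/

section Nearby

variable {m n : ℕ}

/-- Passes from partial derivatives, which the weak topology controls one at a time, to the operator
norm of the derivative. -/
theorem opNorm_le_sum_stdFrame (A : Eu m →L[ℝ] Eu n) : ‖A‖ ≤ ∑ k, ‖stdFrame A k‖ := by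
  refine A.opNorm_le_bound (Finset.sum_nonneg fun _ _ => norm_nonneg _) fun z => ?_
  rw [apply_eq_sum_stdFrame, Finset.sum_mul]
  refine (norm_sum_le _ _).trans (Finset.sum_le_sum fun k _ => ?_)
  rw [norm_smul, mul_comm]
  gcongr
  exact PiLp.norm_apply_le z k

variable {M : Type*} [TopologicalSpace M] [ChartedSpace (Eu m) M]

theorem mfderiv_eq_fderiv_chart (f : Imm m n 2 2 M) (p : M) :
    (mfderiv (𝓡 m) (𝓡 n) f p : Eu m →L[ℝ] Eu n) =
      fderiv ℝ (f ∘ (chartAt (Eu m) p).symm) (chartAt (Eu m) p p) := by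
  have h : MDifferentiableAt (𝓡 m) (𝓡 n) f p := f.1.contMDiff.mdifferentiable two_ne_zero p
  rw [h.mfderiv]
  simp [writtenInExtChartAt]
  rfl

variable [IsManifold (𝓡 m) 2 M]

/-- Immersions near `f` are `C^1` close to `f` in a chart. -/
theorem eventually_chart_close (f : Imm m n 2 2 M) (p : M) {B : Set (Eu m)} (hB : IsCompact B)
    (hBt : B ⊆ (chartAt (Eu m) p).target) {η : ℝ} (hη : 0 < η) :
    ∀ᶠ g : Imm m n 2 2 M in 𝓝 f, ∀ z ∈ B,
      ‖g ((chartAt (Eu m) p).symm z) - f ((chartAt (Eu m) p).symm z)‖ < η ∧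
      ‖fderiv ℝ (g ∘ (chartAt (Eu m) p).symm) z - fderiv ℝ (f ∘ (chartAt (Eu m) p).symm) z‖ ≤
        m * η := by
  set φ := chartAt (Eu m) p with hφ
  set K := φ.symm '' B with hK
  have hKφ : K ⊆ φ.source := by
    rintro _ ⟨z, hz, rfl⟩
    exact φ.map_target (hBt hz)
  have hopen : IsOpen ((fun g : Imm m n 2 2 M => g.1) ⁻¹'
      weakNhd 2 f.1 φ (OpenPartialHomeomorph.refl (Eu n)) K η) := by
    let _ : TopologicalSpace C^2⟮𝓡 m, M; 𝓡 n, Eu n⟯ := weakTopology 2 2 M (Eu n)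
    refine isOpen_induced_iff.2 ⟨_, ?_, rfl⟩
    refine TopologicalSpace.isOpen_generateFrom_of_mem ⟨f.1, φ, _, K, η,
      IsManifold.chart_mem_maximalAtlas p, ?_, hB.image_of_continuousOn
        (φ.continuousOn_symm.mono hBt), hKφ, fun _ _ => mem_univ _, hη, rfl⟩
    exact StructureGroupoid.id_mem_maximalAtlas _
  have hmem : f ∈ ((fun g : Imm m n 2 2 M => g.1) ⁻¹'
      weakNhd 2 f.1 φ (OpenPartialHomeomorph.refl (Eu n)) K η) :=
    ⟨fun _ _ => mem_univ _, fun x _ j _ s => by rwa [sub_self, norm_zero]⟩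
  filter_upwards [hopen.mem_nhds hmem] with g hg z hz
  have hzK : z ∈ φ '' K := ⟨φ.symm z, mem_image_of_mem _ hz, φ.right_inv (hBt hz)⟩
  refine ⟨?_, ?_⟩
  -- Order `0` controls the values; below, order `1` controls each of the `m` columns of the
  -- derivative, whence the factor `m`.
  · have := hg.2 z hzK 0 (by norm_num) Fin.elim0
    simp only [partialDeriv, iteratedFDeriv_zero_apply] at this
    exact this
  · refine (opNorm_le_sum_stdFrame _).trans ?_
    calc _ ≤ ∑ _k : Fin m, η := Finset.sum_le_sum fun k _ => by
          have := hg.2 z hzK 1 (by norm_num) (fun _ => k)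
          simp only [partialDeriv, iteratedFDeriv_one_apply] at this
          exact this.le
      _ = m * η := by simp

theorem contDiffOn_chart (f : Imm m n 2 2 M) (p : M) :
    ContDiffOn ℝ 2 (f ∘ (chartAt (Eu m) p).symm) (chartAt (Eu m) p).target := by
  rw [← contMDiffOn_iff_contDiffOn]
  exact f.1.contMDiff.comp_contMDiffOn contMDiffOn_chart_symm

/-- Reparametrization of an injective linear map to a given isometry with the same range. -/
theorem exists_equiv_comp_eq (A : Eu m →L[ℝ] Eu n) (hA : Function.Injective A)
    (L : Eu m →ₗᵢ[ℝ] Eu n) (h : LinearMap.range L.toLinearMap = LinearMap.range A.toLinearMap) :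
    ∃ Q : Eu m →L[ℝ] Eu m, ∀ z, A (Q z) = L z := by
  let E := LinearEquiv.ofInjective A.toLinearMap hA
  have hL : ∀ z, L z ∈ LinearMap.range A.toLinearMap := fun z => h ▸ ⟨z, rfl⟩
  let Q : Eu m →ₗ[ℝ] Eu m :=
    E.symm.toLinearMap ∘ₗ (L.toLinearMap.codRestrict (LinearMap.range A.toLinearMap) hL)
  refine ⟨LinearMap.toContinuousLinearMap Q, fun z => ?_⟩
  have : E (Q z) = ⟨L z, hL z⟩ := by simp [Q]; rfl
  exact congrArg Subtype.val this

theorem exists_isometry_range (T : Submodule ℝ (Eu n)) (hT : Module.finrank ℝ T = m) :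
    ∃ L : Eu m →ₗᵢ[ℝ] Eu n, LinearMap.range L.toLinearMap = T := by
  let e := (stdOrthonormalBasis ℝ T).reindex (finCongr hT)
  refine ⟨T.subtypeₗᵢ.comp e.repr.symm.toLinearIsometry, ?_⟩
  ext x
  constructor
  · rintro ⟨z, rfl⟩
    exact (e.repr.symm z).2
  · intro hx
    exact ⟨e.repr ⟨x, hx⟩, by simp⟩

/-- Immersions near `f` have nearly flat sheets at a given point, over a common parametrization. -/
theorem exists_nearlyFlat (f : Imm m n 2 2 M) (p : M) (L : Eu m →ₗᵢ[ℝ] Eu n)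
    (hL : LinearMap.range L.toLinearMap = tangentPlane (m := m) f p) {W : Set M} (hW : W ∈ 𝓝 p)
    {ε : ℝ} (hε : 0 < ε) :
    ∃ ψ : Eu m → M, ∃ r₀ > 0, MapsTo ψ (Metric.ball 0 r₀) W ∧
      ContMDiffOn (𝓡 m) (𝓡 m) 2 ψ (Metric.ball 0 r₀) ∧
      ∀ r, 0 < r → r ≤ r₀ → ∀ᶠ g : Imm m n 2 2 M in 𝓝 f,
        NearlyFlat L (f p) r ε (g ∘ ψ) (fderiv ℝ (g ∘ ψ)) := by
  set φ := chartAt (Eu m) p with hφ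
  have hA : Function.Injective (fderiv ℝ (f ∘ φ.symm) (φ p)) := by
    rw [hφ, ← mfderiv_eq_fderiv_chart]
    exact f.2 p
  have hL' : LinearMap.range L.toLinearMap =
      LinearMap.range (fderiv ℝ (f ∘ φ.symm) (φ p)).toLinearMap := by
    rw [hL, hφ, ← mfderiv_eq_fderiv_chart]
    rfl
  obtain ⟨Q, hQ⟩ := exists_equiv_comp_eq _ hA L hL'
  -- This affine change of parameters makes the derivative of `f` at the origin exactly the
  -- prescribed isometry `L`; by continuity it stays within `ε / 2` of `L` on a small ball, leaving
  -- the other half of `ε` for the perturbation.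
  set a : Eu m → Eu m := fun z => φ p + Q z with ha
  have hac : Continuous a := continuous_const.add Q.continuous
  have ha0 : a 0 = φ p := by simp [ha]
  have had : ∀ z, HasFDerivAt a Q z := fun z => (Q.hasFDerivAt).const_add (φ p)
  have htgt : ∀ᶠ z in 𝓝 (0 : Eu m), a z ∈ φ.target := by
    refine hac.continuousAt.eventually ?_
    rw [ha0]
    exact φ.open_target.mem_nhds (φ.map_source (mem_chart_source _ p))
  have hWev : ∀ᶠ z in 𝓝 (0 : Eu m), φ.symm (a z) ∈ W := by
    have : ContinuousAt (fun z => φ.symm (a z)) 0 := by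
      refine ContinuousAt.comp (f := a) (g := φ.symm) ?_ hac.continuousAt
      rw [ha0]
      exact φ.continuousAt_symm (φ.map_source (mem_chart_source _ p))
    refine this.eventually ?_
    change W ∈ 𝓝 (φ.symm (a 0))
    rwa [ha0, φ.left_inv (mem_chart_source _ p)]
  have hDcont : ContinuousAt (fun z => (fderiv ℝ (f ∘ φ.symm) (a z)).comp Q) 0 := by
    have h1 : ContinuousAt (fderiv ℝ (f ∘ φ.symm)) (a 0) := by
      rw [ha0]
      exact (((contDiffOn_chart f p).contDiffAt (φ.open_target.mem_nhds
        (φ.map_source (mem_chart_source _ p)))).fderiv_right (m := 1) (by norm_num)).continuousAt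
    exact (ContinuousAt.comp (f := a) h1 hac.continuousAt).clm_comp continuousAt_const
  have hD0 : (fderiv ℝ (f ∘ φ.symm) (a 0)).comp Q = L.toContinuousLinearMap := by
    ext1 z
    rw [ha0]
    exact hQ z
  have hDev : ∀ᶠ z in 𝓝 (0 : Eu m),
      ‖(fderiv ℝ (f ∘ φ.symm) (a z)).comp Q - L.toContinuousLinearMap‖ < ε / 2 := by
    have := hDcont.eventually (Metric.ball_mem_nhds _ (half_pos hε))
    simpa only [Metric.mem_ball, dist_eq_norm, hD0] using this
  obtain ⟨r₁, hr₁, hball⟩ := Metric.eventually_nhds_iff_ball.1 (htgt.and (hWev.and hDev))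
  refine ⟨fun z => φ.symm (a z), r₁ / 2, half_pos hr₁, ?_, ?_, ?_⟩
  · intro z hz
    exact (hball z (Metric.ball_subset_ball (by linarith) hz)).2.1
  · refine ContMDiffOn.comp (contMDiffOn_chart_symm (x := p)) (t := φ.target) (f := a) ?_ ?_
    · refine ContMDiff.contMDiffOn (ContDiff.contMDiff ?_)
      exact contDiff_const.add Q.contDiff
    · intro z hz
      exact (hball z (Metric.ball_subset_ball (by linarith) hz)).1
  intro r hr hrr
  have hcb : Metric.closedBall (0 : Eu m) r ⊆ Metric.ball 0 r₁ :=
    Metric.closedBall_subset_ball (by linarith)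
  -- The first term gives closeness of the base point relative to `r`; the second absorbs the factor
  -- `m * ‖Q‖` in the derivative, the added ones keeping the denominator positive.
  set η : ℝ := min (ε * r) (ε / (2 * (m * (‖Q‖ + 1)) + 1)) with hη
  have hη0 : 0 < η := by
    have : 0 < 2 * (m * (‖Q‖ + 1)) + 1 := by positivity
    positivity
  have hηQ : m * η * ‖Q‖ ≤ ε / 2 := by
    have h1 : η * (2 * (m * (‖Q‖ + 1)) + 1) ≤ ε := by
      rw [← le_div_iff₀ (by positivity)]
      exact min_le_right _ _
    have : 0 ≤ (m : ℝ) * η := by positivity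
    nlinarith
  filter_upwards [eventually_chart_close f p
    ((isCompact_closedBall (0 : Eu m) r).image hac)
    (by rintro _ ⟨z, hz, rfl⟩; exact (hball z (hcb hz)).1) hη0] with g hg
  have hder : ∀ z ∈ Metric.ball (0 : Eu m) r, HasFDerivAt (g ∘ fun z => φ.symm (a z))
      ((fderiv ℝ (g ∘ φ.symm) (a z)).comp Q) z := by
    intro z hz
    have h1 : DifferentiableAt ℝ (g ∘ φ.symm) (a z) :=
      ((contDiffOn_chart g p).contDiffAt (φ.open_target.mem_nhds
        (hball z (hcb (Metric.ball_subset_closedBall hz))).1)).differentiableAt two_ne_zero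
    exact h1.hasFDerivAt.comp z (had z)
  refine ⟨fun z hz => (hder z hz).differentiableAt.hasFDerivAt, fun z hz => ?_, ?_⟩
  · rw [(hder z hz).fderiv]
    have hzc := Metric.ball_subset_closedBall hz
    have h1 := (hg (a z) (mem_image_of_mem _ hzc)).2
    have h2 := (hball z (hcb hzc)).2.2
    set Dg := fderiv ℝ (g ∘ φ.symm) (a z)
    set Df := fderiv ℝ (f ∘ φ.symm) (a z)
    calc ‖Dg.comp Q - L.toContinuousLinearMap‖ =
          ‖(Dg - Df).comp Q + (Df.comp Q - L.toContinuousLinearMap)‖ := by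
          congr 1; rw [ContinuousLinearMap.sub_comp]; abel
      _ ≤ ‖Dg - Df‖ * ‖Q‖ + ε / 2 := (norm_add_le _ _).trans
          (add_le_add (ContinuousLinearMap.opNorm_comp_le _ _) h2.le)
      _ ≤ m * η * ‖Q‖ + ε / 2 := by gcongr
      _ ≤ ε := by linarith
  · have h1 := (hg (a 0) (mem_image_of_mem _ (Metric.mem_closedBall_self hr.le))).1
    have h2 : φ.symm (a 0) = p := by rw [ha0, φ.left_inv (mem_chart_source _ p)]
    change ‖g (φ.symm (a 0)) - f p‖ ≤ ε * r
    rw [h2] at h1 ⊢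
    exact h1.le.trans (min_le_left _ _)

end Nearby

/-! ### Assembling the sheets at a double point -/

section Conclusion

variable {m n : ℕ}

theorem NearlyFlat.mono {L : Eu m →ₗᵢ[ℝ] Eu n} {q : Eu n} {r ε ε' : ℝ} {G : Eu m → Eu n}
    {D : Eu m → Eu m →L[ℝ] Eu n} (h : NearlyFlat L q r ε G D) (hε : ε ≤ ε') (hr : 0 ≤ r) :
    NearlyFlat L q r ε' G D :=
  ⟨h.hasFDerivAt, fun z hz => (h.norm_sub_le z hz).trans hε,
    h.norm_base_le.trans (mul_le_mul_of_nonneg_right hε hr)⟩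

theorem NearlyFlat.injective_deriv {L : Eu m →ₗᵢ[ℝ] Eu n} {q : Eu n} {r ε : ℝ} {G : Eu m → Eu n}
    {D : Eu m → Eu m →L[ℝ] Eu n} (h : NearlyFlat L q r ε G D) (hε : ε ≤ 1 / 2) {z : Eu m}
    (hz : z ∈ Metric.ball 0 r) : Function.Injective (D z) := by
  rw [injective_iff_map_eq_zero]
  intro v hv
  have h1 := ((D z - L.toContinuousLinearMap).le_opNorm v).trans
    (mul_le_mul_of_nonneg_right (h.norm_sub_le z hz) (norm_nonneg v))
  have h2 : (D z - L.toContinuousLinearMap) v = -L v := by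
    rw [sub_apply, hv, zero_sub]
    rfl
  rw [h2, norm_neg, L.norm_map] at h1
  exact norm_le_zero_iff.1 (by nlinarith [norm_nonneg v])

variable {M : Type*} [TopologicalSpace M] [ChartedSpace (Eu m) M] [IsManifold (𝓡 m) 2 M]

/-- Over a nearly flat sheet the positive frames have a fixed sign relative to the frames of the
parametrization. -/
theorem exists_frame_sign (hm : 1 ≤ m) (g : Imm m n 2 2 M) (hg : Function.Injective g)
    (o : MfdOrientation m M) {L : Eu m →ₗᵢ[ℝ] Eu n} {q : Eu n} {r ε : ℝ} {ψ : Eu m → M}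
    (hψ : ContMDiffOn (𝓡 m) (𝓡 m) 2 ψ (Metric.ball 0 r)) (hε : ε ≤ 1 / 2)
    (h : NearlyFlat L q r ε (g ∘ ψ) (fderiv ℝ (g ∘ ψ))) :
    ∃ s : ℝ, (s = 1 ∨ s = -1) ∧ ∀ z ∈ Metric.ball 0 r,
      (∃ v, IsPosFrame g o (g (ψ z)) v) ∧
      ∀ v, IsPosFrame g o (g (ψ z)) v → ∃ Φ : Matrix (Fin m) (Fin m) ℝ, 0 < s * Φ.det ∧
        ∀ i, v i = ∑ k, Φ k i • stdFrame (fderiv ℝ (g ∘ ψ) z) k := by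
  have hψd : ∀ z ∈ Metric.ball 0 r, MDifferentiableAt (𝓡 m) (𝓡 m) ψ z := fun z hz =>
    (hψ.contMDiffAt (Metric.isOpen_ball.mem_nhds hz)).mdifferentiableAt two_ne_zero
  have hgd : ∀ p, MDifferentiableAt (𝓡 m) (𝓡 n) g p := fun p =>
    g.1.contMDiff.mdifferentiable two_ne_zero p
  have hinj : ∀ z ∈ Metric.ball 0 r, Function.Injective (mfderiv (𝓡 m) (𝓡 m) ψ z) := by
    intro z hz
    have h1 : Function.Injective (mfderiv (𝓡 m) (𝓡 n) (g ∘ ψ) z) := by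
      rw [mfderiv_eq_fderiv]
      exact h.injective_deriv hε hz
    rw [mfderiv_comp z (hgd _) (hψd z hz)] at h1
    exact Function.Injective.of_comp (f := mfderiv (𝓡 m) (𝓡 n) g (ψ z)) h1
  obtain ⟨s, hs, hsign⟩ := exists_orientation_sign o Metric.isOpen_ball
    (convex_ball (0 : Eu m) r).isPreconnected (hψ.of_le one_le_two) hinj
  exact ⟨s, hs, fun z hz => ⟨exists_isPosFrame hm o (ψ z) (g.2 _), fun v hv =>
    hv.exists_matrix (hsign z hz) (hψd z hz) (hinj z hz) (hgd _) hg⟩⟩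

/-- The energy is self-repulsive on every class of immersed submanifolds. -/
theorem selfRepulsiveOn_energy (hm : 1 ≤ m) [T2Space M] (𝒞 : Set (ImmSubmfd m n 2 2 M)) :
    SelfRepulsiveOn (energy (m := m) (n := n) (M := M)) 𝒞 := by
  rintro _ - ⟨f, rfl, p, p', hpp, hfp⟩ C
  have hrank : ∀ x, Module.finrank ℝ (tangentPlane (m := m) f x) = m := fun x =>
    (LinearMap.finrank_range_of_inj (f.2 x)).trans (finrank_tangentSpace x)
  obtain ⟨LA, hLA⟩ := exists_isometry_range _ (hrank p)
  obtain ⟨LB, hLB, hL⟩ : ∃ LB : Eu m →ₗᵢ[ℝ] Eu n,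
      LinearMap.range LB.toLinearMap = tangentPlane (m := m) f p' ∧
      (LA = LB ∨ LinearMap.range LA.toLinearMap ≠ LinearMap.range LB.toLinearMap) := by
    obtain ⟨LB, hLB⟩ := exists_isometry_range _ (hrank p')
    by_cases hT : LinearMap.range LA.toLinearMap = LinearMap.range LB.toLinearMap
    -- For equal tangent planes the same isometry serves both sheets, so their relative orientation
    -- is recorded by the sign `s * t` alone.
    · exact ⟨LA, hT.trans hLB, Or.inl rfl⟩
    · exact ⟨LB, hLB, Or.inr hT⟩
  -- This `ε` works for sheets of every size, so it may be fixed before `r` and the neighbourhood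
  -- are chosen.
  obtain ⟨ε, hε, hlarge⟩ := exists_lt_pairEnergy hm LA LB hL C
  have hε' : 0 < min ε (1 / 2) := by positivity
  -- Disjoint neighbourhoods of `p` and `p'` in `M`, together with injectivity of the embedding,
  -- keep the two sheets disjoint.
  obtain ⟨W, W', hW, hW', hpW, hpW', hWW'⟩ := t2_separation hpp
  obtain ⟨ψA, rA, hrA, hψAW, hψA, hflatA⟩ :=
    exists_nearlyFlat f p LA hLA (hW.mem_nhds hpW) hε'
  obtain ⟨ψB, rB, hrB, hψBW, hψB, hflatB⟩ :=
    exists_nearlyFlat f p' LB hLB (hW'.mem_nhds hpW') hε'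
  set r := min rA rB with hr
  have hr0 : 0 < r := lt_min hrA hrB
  have hsubA : Metric.ball (0 : Eu m) r ⊆ Metric.ball 0 rA :=
    Metric.ball_subset_ball (min_le_left _ _)
  have hsubB : Metric.ball (0 : Eu m) r ⊆ Metric.ball 0 rB :=
    Metric.ball_subset_ball (min_le_right _ _)
  -- Since the projection is open, it suffices to treat the classes of immersions `g` near `f`.
  refine (isOpenMap_mk (m := m) (n := n) (M := M)).nhds_le f ?_
  change ∀ᶠ g in 𝓝 f, _
  filter_upwards [hflatA r hr0 (min_le_left _ _), hflatB r hr0 (min_le_right _ _)]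
    with g hgA hgB g' hg' hemb o
  obtain ⟨χ, hχ⟩ := Quotient.exact hg'
  have hinj : Function.Injective g' := hemb.injective
  -- The given representative `g'` need not be near `f`, only its reparametrization `g` is.
  -- Composing the parametrizations with `χ` exhibits the flat sheets of `g` as sheets of `g'`.
  have eA : (g : M → Eu n) ∘ ψA = g' ∘ (χ ∘ ψA) := funext fun z => hχ (ψA z)
  have eB : (g : M → Eu n) ∘ ψB = g' ∘ (χ ∘ ψB) := funext fun z => hχ (ψB z)
  rw [eA] at hgA
  rw [eB, ← hfp] at hgB
  obtain ⟨s, hs, hsign⟩ := exists_frame_sign hm g' hinj o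
    (χ.contMDiff.comp_contMDiffOn (hψA.mono hsubA)) (min_le_right _ _) hgA
  obtain ⟨t, ht, htign⟩ := exists_frame_sign hm g' hinj o
    (χ.contMDiff.comp_contMDiffOn (hψB.mono hsubB)) (min_le_right _ _) hgB
  have hne : ∀ z ∈ Metric.ball 0 r, ∀ z' ∈ Metric.ball 0 r,
      (g' ∘ (χ ∘ ψA)) z ≠ (g' ∘ (χ ∘ ψB)) z' := by
    intro z hz z' hz' heq
    have h1 : ψA z = ψB z' := χ.injective (hinj heq)
    exact disjoint_left.1 hWW' (hψAW (hsubA hz)) (h1 ▸ hψBW (hsubB hz'))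
  refine hlarge r hr0 (range g') (cosCombinedAngle g' o) (s * t) (f p) (g' ∘ (χ ∘ ψA))
    (g' ∘ (χ ∘ ψB)) (fderiv ℝ (g' ∘ (χ ∘ ψA))) (fderiv ℝ (g' ∘ (χ ∘ ψB))) ?_
    ⟨hgA.mono (min_le_left _ _) hr0.le, hgB.mono (min_le_left _ _) hr0.le,
      fun z _ => mem_range_self _, fun z _ => mem_range_self _, hne, fun z hz z' hz' => ?_⟩
  · rcases hs with rfl | rfl <;> rcases ht with rfl | rfl <;> norm_num
  · exact cosCombinedAngle_eq hm (hne z hz z' hz') hs ht (hsign z hz).1 (htign z' hz').1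
      (hsign z hz).2 (htign z' hz').2

end Conclusion

end

end KusnerSullivan

theorem theorem2 {m n : ℕ} (hm : 1 ≤ m)
    (M : Type*) [TopologicalSpace M] [CompactSpace M] [T2Space M]
    [ChartedSpace (EuclideanSpace ℝ (Fin m)) M] [IsManifold (𝓡 m) 2 M]
    (ε₀ b : ℝ) (hε₀ : 0 < ε₀) (hb : 0 < b) :
    KusnerSullivan.SelfRepulsiveOn (KusnerSullivan.energy (m := m) (n := n) (M := M))
      (KusnerSullivan.boundedGeometry m n 2 2 M ε₀ b ⊤) := by
  exact KusnerSullivan.selfRepulsiveOn_energy hm _
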